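/- A graph class $\mathcal G$ is a class of finite simple graphs closed under isomorphism. Call $\mathcal G$ sustainable if every graph $G\in\mathcal G$ can be enlarged to a graph in $\mathcal G$ by adding one vertex, i.e. there are $G'\in\mathcal G$ and $v\in V(G')$ with $G'-v=G$, where such an extension $(G',v)$ can be constructed from $G$ in polynomial time. For a fixed $k\ge 1$, the decision version of Fair $k$-Division Under Conflicts with conflict graphs from $\mathcal G$ is the following problem. An instance consists of a graph $G=(V,E)\in\mathcal G$, profit functions $p_1,\dots,p_k\colon V\to\mathbb Z_{\ge 0}$ and a number $q\in\mathbb Z_{\ge 0}$ (numbers are written in binary). The question is whether there are pairwise disjoint independent sets $X_1,\dots,X_k$ of $G$ with $\min_{1\le j\le k}\sum_{v\in X_j}p_j(v)\ge q$. Theorem. Let $\mathcal G$ be a sustainable graph class and let $k\ge 1$. If the decision version of Fair $k$-Division Under Conflicts with conflict graphs from $\mathcal G$ is NP-complete, then for every $\ell\ge k$ the decision version of Fair $\ell$-Division Under Conflicts with conflict graphs from $\mathcal G$ is NP-complete. The same holds with "strongly NP-complete" in place of "NP-complete" in both the assumption and the conclusion. Here NP-completeness is with respect to polynomial-time many-one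 reductions, and the inputs of the problem are its instances, i.e. the graph is promised to belong to $\mathcal G$. A problem in NP is strongly NP-complete if, for some polynomial $P$, it is NP-complete when restricted to the instances in which every number is at most $P$ of the instance length. -/

import Mathlib

/-! ### Decision problems, polynomial time, NP-completeness -/

/-- An injective coding by strings, as an encoding in the sense of Mathlib. -/
noncomputable def encodingOfInjective {α Γ : Type} (f : α → List Γ)
    (hf : Function.Injective f) : Computability.Encoding α Γ where
  encode := f
  decode := Function.partialInv f
  decode_encode := Function.partialInv_left hf

/-- A decision problem: a set of instances, each written as a string over a finite alphabet, and
the property of being a yes-instance. An algorithm for the problem receives only strings that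
encode instances. -/
structure DecisionProblem where
  /-- the instances -/
  Inst : Type
  /-- the alphabet -/
  Alphabet : Type
  [alphabetFintype : Fintype Alphabet]
  /-- the encoding of instances as strings -/
  enc : Computability.Encoding Inst Alphabet
  /-- the yes-instances -/
  Yes : Inst → Prop

namespace DecisionProblem

/-- The length of the encoding of an instance. -/
def size (P : DecisionProblem) (x : P.Inst) : ℕ := (P.enc.encode x).length

/-- `P` is in NP: there are a polynomial `p` and a deterministic Turing machine `V` that runs in
polynomial time on pairs consisting of an instance and a binary string, such that `x` is a
yes-instance if and only if `V` accepts `(x, y)` for some `y` of length at most `p (size x)`. -/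
def InNP (P : DecisionProblem) : Prop :=
  ∃ (p : Polynomial ℕ) (V : P.Inst × List Bool → Bool),
    Nonempty (Turing.TM2ComputableInPolyTime
      (Computability.encodingProd P.enc (Computability.encodingList Bool)).encode
      Computability.encodeBool V) ∧
    ∀ x : P.Inst, P.Yes x ↔ ∃ y : List Bool, y.length ≤ p.eval (P.size x) ∧ V (x, y) = true

/-- Polynomial-time many-one (Karp) reducibility. -/
def ReducesTo (P Q : DecisionProblem) : Prop :=
  ∃ f : P.Inst → Q.Inst,
    Nonempty (Turing.TM2ComputableInPolyTime P.enc.encode Q.enc.encode f) ∧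
    ∀ x : P.Inst, P.Yes x ↔ Q.Yes (f x)

/-- NP-completeness under polynomial-time many-one reductions. -/
def NPComplete (P : DecisionProblem) : Prop :=
  P.InNP ∧ ∀ Q : DecisionProblem, Q.InNP → Q.ReducesTo P

/-- The restriction of a problem to the instances that satisfy `D`. -/
noncomputable def restrict (P : DecisionProblem) (D : P.Inst → Prop) : DecisionProblem where
  Inst := {x : P.Inst // D x}
  Alphabet := P.Alphabet
  alphabetFintype := P.alphabetFintype
  enc := encodingOfInjective (fun x => P.enc.encode x.1)
    (P.enc.encode_injective.comp Subtype.val_injective)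
  Yes x := P.Yes x.1

/-- Strong NP-completeness of a number problem `P`, where `maxNum x` is the largest number that
occurs in the instance `x`: the problem is in NP, and for some polynomial `p` it is NP-complete
when restricted to the instances `x` with `maxNum x ≤ p (size x)`. -/
def StronglyNPComplete (P : DecisionProblem) (maxNum : P.Inst → ℕ) : Prop :=
  P.InNP ∧ ∃ p : Polynomial ℕ, (P.restrict fun x => maxNum x ≤ p.eval (P.size x)).NPComplete

end DecisionProblem

/-! ### Graph classes -/

/-- A class of finite simple graphs, closed under isomorphism. Every finite graph is represented
by its isomorphic copies on the vertex sets `Fin n`. -/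
structure GraphClass where
  /-- membership in the class -/
  Mem : ∀ {n : ℕ}, SimpleGraph (Fin n) → Prop
  /-- closure under isomorphism -/
  mem_of_iso : ∀ {m n : ℕ} {G : SimpleGraph (Fin m)} {H : SimpleGraph (Fin n)},
    Nonempty (G ≃g H) → Mem G → Mem H

/-- A finite graph, on the vertex set `Fin n` for some `n`. -/
abbrev FinGraph : Type := Σ n : ℕ, SimpleGraph (Fin n)

section Encodings

open Computability (Γ' encodeNat)

open Classical in
/-- A graph is encoded by its adjacency matrix, row by row, each row followed by a comma. -/
noncomputable def encodeGraph (G : FinGraph) : List Γ' :=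
  (List.finRange G.1).flatMap fun i =>
    (List.finRange G.1).map (fun j => Γ'.bit (decide (G.2.Adj i j))) ++ [Γ'.comma]

/-- A natural number is encoded in binary, followed by a comma. -/
def encodeNumber (a : ℕ) : List Γ' := (encodeNat a).map Γ'.bit ++ [Γ'.comma]

end Encodings

/-- The class `𝒢` is sustainable, with extensions that can be constructed efficiently: every graph
`G ∈ 𝒢` can be enlarged to a graph `ext G ∈ 𝒢` by adding one vertex, that is, `ext G` has a vertex
(the last one) whose deletion gives `G`, and `ext G` can be computed from `G ∈ 𝒢` in polynomial
time. -/
def GraphClass.SustainableInPolyTime (𝒢 : GraphClass) : Prop :=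
  ∃ ext : ∀ {n : ℕ}, SimpleGraph (Fin n) → SimpleGraph (Fin (n + 1)),
    (∀ {n : ℕ} (G : SimpleGraph (Fin n)), 𝒢.Mem G →
      𝒢.Mem (ext G) ∧ (ext G).comap Fin.castSucc = G) ∧
    Nonempty (Turing.TM2ComputableInPolyTime
      (fun G : {G : FinGraph // 𝒢.Mem G.2} => encodeGraph G.1) encodeGraph
      (fun G => ⟨G.1.1 + 1, ext G.1.2⟩))

/-! ### Fair k-division under conflicts -/

/-- A partial `k`-coloring: a sequence of `k` pairwise disjoint independent sets. -/
structure PartialColoring {n : ℕ} (G : SimpleGraph (Fin n)) (k : ℕ) where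
  /-- the color classes -/
  X : Fin k → Finset (Fin n)
  disjoint : Pairwise fun i j => Disjoint (X i) (X j)
  indep : ∀ j, G.IsIndepSet (X j : Set (Fin n))

/-- The satisfaction level of a partial `k`-coloring, `k ≥ 1`: the minimum over all colors `j` of
the profit `p j (X j)`. -/
noncomputable def PartialColoring.satisfactionLevel {n k : ℕ} {G : SimpleGraph (Fin n)}
    (c : PartialColoring G k) (p : Fin k → Fin n → ℕ) : ℕ :=
  ⨅ j : Fin k, ∑ v ∈ c.X j, p j v

/-- An instance of the decision version of Fair `k`-Division Under Conflicts with a conflict graph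
from `𝒢`: a graph, `k` profit functions, and a required satisfaction level `q`. -/
structure FairInstance (k : ℕ) (𝒢 : GraphClass) where
  /-- the number of items -/
  n : ℕ
  /-- the conflict graph -/
  graph : SimpleGraph (Fin n)
  mem : 𝒢.Mem graph
  /-- the profit functions -/
  profit : Fin k → Fin n → ℕ
  /-- the required satisfaction level -/
  q : ℕ

namespace FairInstance

open Computability (Γ' encodeNat)

/-- The largest number that occurs in an instance. -/
def maxNum {k : ℕ} {𝒢 : GraphClass} (I : FairInstance k 𝒢) : ℕ :=
  max I.q (Finset.univ.sup fun j => Finset.univ.sup fun v => I.profit j v)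

/-- An instance is encoded by its graph, the number `q` in binary, and the `k` lists of profits in
binary. -/
noncomputable def encode {k : ℕ} {𝒢 : GraphClass} (I : FairInstance k 𝒢) : List Γ' :=
  encodeGraph ⟨I.n, I.graph⟩ ++ Γ'.ket :: (encodeNumber I.q ++
    (List.finRange k).flatMap fun j =>
      (List.finRange I.n).flatMap (fun v => encodeNumber (I.profit j v)) ++ [Γ'.ket])

theorem append_cons_cancel {c : Γ'} : ∀ {a a' b b' : List Γ'}, c ∉ a → c ∉ a' →
    a ++ c :: b = a' ++ c :: b' → a = a' ∧ b = b'
  | [], [], _, _, _, _, h => by simpa using h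
  | [], x :: a', _, _, _, h2, h => by simp at h h2; exact absurd h.1 h2.1
  | x :: a, [], _, _, h1, _, h => by simp at h h1; exact absurd h.1.symm h1.1
  | x :: a, y :: a', b, b', h1, h2, h => by
    simp only [List.cons_append, List.cons.injEq, List.mem_cons, not_or] at h h1 h2
    obtain ⟨e1, e2⟩ := append_cons_cancel h1.2 h2.2 h.2
    exact ⟨by rw [h.1, e1], e2⟩

theorem flatMap_cancel {ι : Type} {c : Γ'} {f g : ι → List Γ'} :
    ∀ {l : List ι} {b b' : List Γ'}, (∀ i, c ∉ f i) → (∀ i, c ∉ g i) →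
    (l.flatMap fun i => f i ++ [c]) ++ b = (l.flatMap fun i => g i ++ [c]) ++ b' →
    (∀ i ∈ l, f i = g i) ∧ b = b'
  | [], _, _, _, _, h => by simpa using h
  | i :: l, b, b', hf, hg, h => by
    simp only [List.flatMap_cons, List.append_assoc, List.singleton_append] at h
    obtain ⟨e1, e2⟩ := append_cons_cancel (hf i) (hg i) h
    obtain ⟨e3, e4⟩ := flatMap_cancel hf hg e2
    exact ⟨by simpa [e1] using e3, e4⟩

theorem encodeGraph_injective : Function.Injective encodeGraph := by
  classical
  have hc : ∀ G : FinGraph, (encodeGraph G).count Γ'.comma = G.1 := by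
    intro G
    have h0 : ∀ i : Fin G.1, ((List.finRange G.1).map
        (fun j => Γ'.bit (decide (G.2.Adj i j)))).count Γ'.comma = 0 := by
      intro i
      rw [List.count_eq_zero]
      simp
    simp only [encodeGraph, List.count_flatMap, Function.comp_def, List.count_append, h0]
    simp
  rintro ⟨n, G⟩ ⟨m, H⟩ h
  obtain rfl : n = m := by simpa [h, hc] using (hc ⟨n, G⟩).symm
  congr 1
  have := (flatMap_cancel (c := Γ'.comma) (b := []) (b' := [])
    (f := fun i => (List.finRange n).map (fun j => Γ'.bit (decide (G.Adj i j))))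
    (g := fun i => (List.finRange n).map (fun j => Γ'.bit (decide (H.Adj i j))))
    (l := List.finRange n) (by simp) (by simp) (by simpa [encodeGraph] using h)).1
  ext i j
  have e := this i (List.mem_finRange i)
  simp at e
  exact e j

theorem encodeNumber_cancel {a a' : ℕ} {b b' : List Γ'}
    (h : encodeNumber a ++ b = encodeNumber a' ++ b') : a = a' ∧ b = b' := by
  simp only [encodeNumber, List.append_assoc, List.singleton_append] at h
  obtain ⟨e1, e2⟩ := append_cons_cancel (by simp) (by simp) h
  have hb : Function.Injective Γ'.bit := fun x y h => by simpa using h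
  refine ⟨?_, e2⟩
  have := hb.list_map e1
  rw [← Computability.decode_encodeNat a, this, Computability.decode_encodeNat]

theorem encode_injective (k : ℕ) (𝒢 : GraphClass) :
    Function.Injective (encode : FairInstance k 𝒢 → List Γ') := by
  have hg : ∀ G : FinGraph, Γ'.ket ∉ encodeGraph G := by intro G; simp [encodeGraph]
  rintro ⟨n, G, hG, p, q⟩ ⟨m, H, hH, p', q'⟩ h
  simp only [encode] at h
  obtain ⟨e1, e2⟩ := append_cons_cancel (hg _) (hg _) h
  obtain ⟨rfl, e1⟩ := Sigma.mk.inj (encodeGraph_injective e1)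
  obtain rfl := eq_of_heq e1
  obtain ⟨rfl, e3⟩ := encodeNumber_cancel e2
  have hn : ∀ p : Fin k → Fin n → ℕ, ∀ j,
      Γ'.ket ∉ (List.finRange n).flatMap (fun v => encodeNumber (p j v)) := by
    intro p j; simp [encodeNumber]
  have e4 := (flatMap_cancel (b := []) (b' := []) (hn p) (hn p') (by simpa using e3)).1
  congr 1
  funext j v
  have e5 := e4 j (List.mem_finRange j)
  have hb : Function.Injective Γ'.bit := fun x y h => by simpa using h
  have e6 := hb.list_map <| (flatMap_cancel (c := Γ'.comma) (b := []) (b' := [])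
    (f := fun v => (encodeNat (p j v)).map Γ'.bit) (g := fun v => (encodeNat (p' j v)).map Γ'.bit)
    (l := List.finRange n) (by simp) (by simp) (by simpa [encodeNumber] using e5)).1 v
    (List.mem_finRange v)
  rw [← Computability.decode_encodeNat (p j v), e6, Computability.decode_encodeNat]

end FairInstance

/-- The decision version of Fair `k`-Division Under Conflicts with conflict graphs from `𝒢`: is
there a partial `k`-coloring with satisfaction level at least `q`? -/
noncomputable def fairDivision (k : ℕ) (𝒢 : GraphClass) : DecisionProblem where
  Inst := FairInstance k 𝒢
  Alphabet := Computability.Γ'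
  enc := encodingOfInjective FairInstance.encode (FairInstance.encode_injective k 𝒢)
  Yes I := ∃ c : PartialColoring I.graph k, I.q ≤ c.satisfactionLevel I.profit

/-! ### Stack programs -/

/-! It suffices to pass from `k` to `k + 1` colors and iterate. Given an instance with graph `G`,
profits `p` and bound `q`, let `H` be the extension of `G` by one vertex `w` that sustainability
provides. Add one color. Its profit is `q` at `w` and zero elsewhere, and `w` is worth nothing to
the old colors. A solution on `H` restricts to `G`: deleting `w` costs the old colors nothing.
Conversely, a solution on `G` is completed by the class `{w}`, which is independent however `w` is
joined to `G`. This is `exists_coloring_extendProfit_iff`. No number exceeds the old maximum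
(`maxNum_extend_le`) and the encoding does not get shorter (`length_encode_le_extend`), so the same
polynomial bounds the numbers in the strong version.

Hardness is transported by transitivity of Karp reductions, hence by closure of polynomial time
under composition (`comp_polyTime`). Membership in NP is proved for every graph class, since
membership of the graph is promised: a certificate lists the colors of the vertices
(`fairDivision_inNP`).

Most of the work is to show that the reduction and the verifier run in polynomial time on a Turing
machine. Both are written in a small language of stack programs with sequencing and loops, where
`Runs` records the result, the final stacks and a time bound. `polyTime` turns such a program into a
Turing machine, and `exists_of_polyTime` does the reverse, so that a machine given by hypothesis can
be used as a subroutine on its own stacks.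

The reduction feeds the graph part of the input to the machine for the extension and edits the
remaining string in one pass (`polyTime_extend`). The verifier reads the instance once from left to
right. It checks the adjacency matrix against the colors, adds up the profits of each color in
binary, and compares each sum with `q`. The function `run` describes this pass; `run_encode` proves
it correct and `runs_program` implements it. -/

namespace StackProgram

open Function (update)

/-- An instruction of a stack program with control states `Q`. -/
inductive Instr {K : Type} (Γ : K → Type) (Q : Type) : Type
  | push (k : K) (a : Γ k) (q : Q)
  | pop (k : K) (f : Option (Γ k) → Q)
  | peek (k : K) (f : Option (Γ k) → Q)
  | jump (q : Q)

namespace Instr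

variable {K : Type} {Γ : K → Type} {Q Q' : Type}

/-- Relabelling of the successor states. -/
def map (g : Q → Q') : Instr Γ Q → Instr Γ Q'
  | push k a q => push k a (g q)
  | pop k f => pop k fun o => g (f o)
  | peek k f => peek k fun o => g (f o)
  | jump q => jump (g q)

/-- The successor state. -/
def next (S : ∀ k, List (Γ k)) : Instr Γ Q → Q
  | push _ _ q => q
  | pop k f => f (S k).head?
  | peek k f => f (S k).head?
  | jump q => q

/-- The effect on the stacks. -/
def act [DecidableEq K] (S : ∀ k, List (Γ k)) : Instr Γ Q → ∀ k, List (Γ k)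
  | push k a _ => update S k (a :: S k)
  | pop k _ => update S k (S k).tail
  | peek _ _ => S
  | jump _ => S

/-- Renaming of the stacks. -/
def lift {K' : Type} {Γ' : K' → Type} (ι : K → K') :
    Instr (fun k => Γ' (ι k)) Q → Instr Γ' Q
  | push k a q => push (ι k) a q
  | pop k f => pop (ι k) f
  | peek k f => peek (ι k) f
  | jump q => jump q

@[simp] theorem next_map (g : Q → Q') (S : ∀ k, List (Γ k)) (i : Instr Γ Q) :
    (i.map g).next S = g (i.next S) := by cases i <;> rfl

@[simp] theorem act_map [DecidableEq K] (g : Q → Q') (S : ∀ k, List (Γ k)) (i : Instr Γ Q) :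
    (i.map g).act S = i.act S := by cases i <;> rfl

end Instr

/-- A program with finite control that acts on stacks and returns a value in `β`. -/
structure Code {K : Type} (Γ : K → Type) (β : Type) : Type 1 where
  /-- the control states -/
  Q : Type
  [finite : Finite Q]
  /-- where to begin -/
  entry : Q ⊕ β
  /-- the program text -/
  code : Q → Instr Γ (Q ⊕ β)

attribute [instance] Code.finite

namespace Code

variable {K : Type} [DecidableEq K] {Γ : K → Type} {α β σ : Type}

/-- `c.RunsFrom q S b S' t`: from state `q` and stacks `S`, the program `c` returns `b` with the
stacks `S'` after at most `t` steps. -/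
inductive RunsFrom (c : Code Γ β) :
    c.Q ⊕ β → (∀ k, List (Γ k)) → β → (∀ k, List (Γ k)) → ℕ → Prop
  | done (b S t) : RunsFrom c (.inr b) S b S t
  | step (q S b S' t) : RunsFrom c ((c.code q).next S) ((c.code q).act S) b S' t →
      RunsFrom c (.inl q) S b S' (t + 1)

/-- `c.Runs S b S' t`: started with the stacks `S`, the program `c` returns `b` with the stacks
`S'` after at most `t` steps. -/
def Runs (c : Code Γ β) (S : ∀ k, List (Γ k)) (b : β) (S' : ∀ k, List (Γ k)) (t : ℕ) : Prop :=
  c.RunsFrom c.entry S b S' t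

theorem RunsFrom.mono {c : Code Γ β} {q S b S' t t'} (h : c.RunsFrom q S b S' t) (ht : t ≤ t') :
    c.RunsFrom q S b S' t' := by
  induction h generalizing t' with
  | done => exact .done ..
  | step q S b S' t _ ih =>
    obtain ⟨t', rfl⟩ := Nat.exists_eq_add_of_le' (show 1 ≤ t' by omega)
    exact .step _ _ _ _ _ (ih (by omega))

theorem Runs.mono {c : Code Γ β} {S b S' t t'} (h : c.Runs S b S' t) (ht : t ≤ t') :
    c.Runs S b S' t' :=
  RunsFrom.mono h ht

theorem Runs.of_eq {c : Code Γ β} {S S₁ b S' S₁' t t'} (h : c.Runs S₁ b S₁' t) (hS : S = S₁)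
    (hS' : S' = S₁') (ht : t ≤ t') : c.Runs S b S' t' := by
  subst hS hS'
  exact h.mono ht

/-- Return a value. -/
def pure (b : β) : Code Γ β where
  Q := Empty
  entry := .inr b
  code := Empty.elim

/-- Push a symbol. -/
def push (k : K) (a : Γ k) : Code Γ Unit where
  Q := Unit
  entry := .inl ()
  code _ := .push k a (.inr ())

/-- Pop a symbol and return a function of it. -/
def pop (k : K) (f : Option (Γ k) → β) : Code Γ β where
  Q := Unit
  entry := .inl ()
  code _ := .pop k fun o => .inr (f o)

/-- Return a function of the top symbol. -/
def peek (k : K) (f : Option (Γ k) → β) : Code Γ β where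
  Q := Unit
  entry := .inl ()
  code _ := .peek k fun o => .inr (f o)

/-- Run `c`, then the program selected by its result. -/
def bind [Finite α] (c : Code Γ α) (f : α → Code Γ β) : Code Γ β where
  Q := c.Q ⊕ Σ a, (f a).Q
  entry := c.entry.elim (fun q => .inl (.inl q))
    fun a => (f a).entry.map (fun q => .inr ⟨a, q⟩) id
  code := Sum.elim
    (fun q => (c.code q).map fun r => r.elim (fun q => .inl (.inl q))
      fun a => (f a).entry.map (fun q => .inr ⟨a, q⟩) id)
    fun p => ((f p.1).code p.2).map fun r => r.map (fun q => .inr ⟨p.1, q⟩) id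

/-- Run `body` on a state, repeatedly, until it returns a result. -/
def loop [Finite σ] (body : σ → Code Γ (σ ⊕ β)) (s : σ) : Code Γ β where
  Q := σ ⊕ Σ s, (body s).Q
  entry := .inl (.inl s)
  code := Sum.elim
    (fun s => .jump ((body s).entry.elim (fun q => .inl (.inr ⟨s, q⟩))
      fun r => r.map (fun s' => .inl s') id))
    fun p => ((body p.1).code p.2).map fun r => r.elim (fun q => .inl (.inr ⟨p.1, q⟩))
      fun r => r.map (fun s' => .inl s') id

/-- Renaming of the stacks. -/
def lift {K' : Type} {Γ' : K' → Type} (ι : K → K') (c : Code (fun k => Γ' (ι k)) β) :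
    Code Γ' β where
  Q := c.Q
  entry := c.entry
  code q := (c.code q).lift ι

/-! ### Running times of the basic programs, of sequencing and of loops. -/

theorem runs_pure (b : β) (S : ∀ k, List (Γ k)) (t : ℕ) : (pure b : Code Γ β).Runs S b S t :=
  .done ..

theorem runs_push (k : K) (a : Γ k) (S : ∀ k, List (Γ k)) (t : ℕ) :
    (push k a).Runs S () (update S k (a :: S k)) (t + 1) :=
  .step _ _ _ _ _ (.done ..)

theorem runs_pop (k : K) (f : Option (Γ k) → β) (S : ∀ k, List (Γ k)) (t : ℕ) :
    (pop k f).Runs S (f (S k).head?) (update S k (S k).tail) (t + 1) :=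
  .step _ _ _ _ _ (.done ..)

theorem runs_peek (k : K) (f : Option (Γ k) → β) (S : ∀ k, List (Γ k)) (t : ℕ) :
    (peek k f).Runs S (f (S k).head?) S (t + 1) :=
  .step _ _ _ _ _ (.done ..)

theorem RunsFrom.bind_right [Finite α] {c : Code Γ α} {f : α → Code Γ β} {a q S b S' t}
    (h : (f a).RunsFrom q S b S' t) :
    (c.bind f).RunsFrom (q.map (fun q => .inr ⟨a, q⟩) id) S b S' t := by
  induction h with
  | done => exact .done ..
  | step q S b S' t _ ih =>
    refine .step _ _ _ _ _ ?_
    simpa [Code.bind] using ih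

theorem RunsFrom.bind [Finite α] {c : Code Γ α} {f : α → Code Γ β} {q S a S' b S'' t t'}
    (h : c.RunsFrom q S a S' t) (h' : (f a).Runs S' b S'' t') :
    (c.bind f).RunsFrom (q.elim (fun q => .inl (.inl q))
      fun a => (f a).entry.map (fun q => .inr ⟨a, q⟩) id) S b S'' (t + t') := by
  induction h with
  | done => exact h'.bind_right.mono (Nat.le_add_left ..)
  | step q S b S' t _ ih =>
    rw [Nat.add_right_comm]
    refine .step _ _ _ _ _ ?_
    simpa [Code.bind] using ih h'

theorem Runs.bind [Finite α] {c : Code Γ α} {f : α → Code Γ β} {S a S' b S'' t t'}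
    (h : c.Runs S a S' t) (h' : (f a).Runs S' b S'' t') :
    (c.bind f).Runs S b S'' (t + t') :=
  RunsFrom.bind h h'

theorem Runs.bind_pure [Finite α] {c : Code Γ α} {f : α → β} {S a S' t} (h : c.Runs S a S' t) :
    (c.bind fun a => pure (f a)).Runs S (f a) S' t :=
  h.bind (f := fun a => pure (f a)) (runs_pure _ _ 0)

theorem RunsFrom.loop_body [Finite σ] {body : σ → Code Γ (σ ⊕ β)} {s₀ s q r S S' b S'' t t'}
    (h : (body s).RunsFrom q S r S' t)
    (h' : (loop body s₀).RunsFrom (r.map (fun s' => .inl s') id) S' b S'' t') :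
    (loop body s₀).RunsFrom (q.elim (fun q => .inl (.inr ⟨s, q⟩))
      fun r => r.map (fun s' => .inl s') id) S b S'' (t + t') := by
  induction h with
  | done => exact h'.mono (Nat.le_add_left ..)
  | step q S b S' t _ ih =>
    rw [Nat.add_right_comm]
    refine .step _ _ _ _ _ ?_
    simpa [Code.loop] using ih h'

/-- The initial state of a loop affects only its entry point, not its program text, so runs from a
given control state agree. -/
theorem RunsFrom.loop_entry [Finite σ] {body : σ → Code Γ (σ ⊕ β)} {s s' q S b S' t}
    (h : (loop body s).RunsFrom q S b S' t) : (loop body s').RunsFrom q S b S' t := by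
  induction h with
  | done => exact .done ..
  | step q S b S' t _ ih => exact .step _ _ _ _ _ ih

theorem Runs.loop_exit [Finite σ] {body : σ → Code Γ (σ ⊕ β)} {s S b S' t}
    (h : (body s).Runs S (.inr b) S' t) : (loop body s).Runs S b S' (t + 1) :=
  .step _ _ _ _ _ (RunsFrom.loop_body (t' := 0) h (.done ..))

theorem Runs.loop_continue [Finite σ] {body : σ → Code Γ (σ ⊕ β)} {s s' S S' b S'' t t'}
    (h : (body s).Runs S (.inl s') S' t) (h' : (loop body s').Runs S' b S'' t') :
    (loop body s).Runs S b S'' (t + t' + 1) :=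
  .step _ _ _ _ _ (RunsFrom.loop_body h
    (RunsFrom.loop_entry (q := .inl (.inl s')) (s := s') (s' := s) h'))

/-- Frame rule: a program on renamed stacks acts as before on the image of the injective renaming
and leaves every other stack alone. -/
theorem Runs.lift {K' : Type} [DecidableEq K'] {Γ' : K' → Type} {ι : K → K'}
    (hι : Function.Injective ι) {c : Code (fun k => Γ' (ι k)) β} {T b T' t}
    (h : c.Runs T b T' t) {S S' : ∀ k, List (Γ' k)} (hS : ∀ k, S (ι k) = T k)
    (hS' : ∀ k, S' (ι k) = T' k) (hn : ∀ k, k ∉ Set.range ι → S' k = S k) :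
    (c.lift ι).Runs S b S' t := by
  unfold Runs at h ⊢
  change (c.lift ι).RunsFrom c.entry S b S' t
  generalize c.entry = q at h ⊢
  induction h generalizing S with
  | done b T t =>
    obtain rfl : S = S' := by
      funext k
      by_cases hk : k ∈ Set.range ι
      · obtain ⟨k, rfl⟩ := hk
        rw [hS, hS']
      · exact (hn k hk).symm
    exact .done ..
  | step q T b T' t _ ih =>
    refine .step _ _ _ _ _ ?_
    have e : ((c.lift ι).code q).next S = (c.code q).next T := by
      simp only [Code.lift]
      cases c.code q <;> simp [Instr.lift, Instr.next, hS]
    rw [e]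
    refine ih ?_ hS' ?_
    · intro k
      simp only [Code.lift]
      rcases c.code q with ⟨k', a, _⟩ | ⟨k', _⟩ | ⟨k', _⟩ | _ <;>
        simp only [Instr.lift, Instr.act, hS]
      all_goals
        by_cases hk : k = k'
        · subst hk; simp
        · rw [Function.update_of_ne (fun h => hk (hι h)), Function.update_of_ne hk, hS]
    · intro k hk
      rw [hn k hk]
      simp only [Code.lift]
      cases c.code q <;> simp only [Instr.lift, Instr.act]
      all_goals
        rw [Function.update_of_ne]
        rintro rfl
        exact hk ⟨_, rfl⟩

/-! Rules for sequential execution. -/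

theorem Runs.push_bind {k : K} {a : Γ k} {f : Unit → Code Γ β} {S b S' t}
    (h : (f ()).Runs (update S k (a :: S k)) b S' t) :
    ((push k a).bind f).Runs S b S' (t + 1) := by
  rw [add_comm]
  exact (runs_push k a S 0).bind h

theorem Runs.pop_bind [Finite α] {k : K} {g : Option (Γ k) → α} {f : α → Code Γ β} {S b S' t}
    (h : (f (g (S k).head?)).Runs (update S k (S k).tail) b S' t) :
    ((pop k g).bind f).Runs S b S' (t + 1) := by
  rw [add_comm]
  exact (runs_pop k g S 0).bind h

theorem Runs.peek_bind [Finite α] {k : K} {g : Option (Γ k) → α} {f : α → Code Γ β} {S b S' t}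
    (h : (f (g (S k).head?)).Runs S b S' t) :
    ((peek k g).bind f).Runs S b S' (t + 1) := by
  rw [add_comm]
  exact (runs_peek k g S 0).bind h

/-- The number of pushes, hence the growth of the stacks, is bounded by the number of steps. -/
theorem RunsFrom.length_le {c : Code Γ β} {q S b S' t} (h : c.RunsFrom q S b S' t) (k : K) :
    (S' k).length ≤ (S k).length + t := by
  induction h with
  | done => exact Nat.le_add_right ..
  | step q S b S' t _ ih =>
    have : ((c.code q).act S k).length ≤ (S k).length + 1 := by
      rcases c.code q with ⟨k', a, _⟩ | ⟨k', _⟩ | ⟨k', _⟩ | _ <;> simp only [Instr.act] <;>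
        try exact Nat.le_add_right ..
      all_goals
        by_cases hk : k = k'
        · subst hk; simp; try omega
        · rw [Function.update_of_ne hk]; omega
    omega

theorem Runs.length_le {c : Code Γ β} {S b S' t} (h : c.Runs S b S' t) (k : K) :
    (S' k).length ≤ (S k).length + t :=
  RunsFrom.length_le h k

end Code

end StackProgram

/-! ### Stack programs and Turing machines -/

namespace StackProgram

open Function (update)
open Turing StateTransition

/-- All stacks are empty, except that `k` holds `l`. -/
def single {K : Type} [DecidableEq K] {Γ : K → Type} (k : K) (l : List (Γ k)) :
    ∀ k, List (Γ k) :=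
  update (fun _ => []) k l

namespace Code

variable {K : Type} [DecidableEq K] {Γ : K → Type} {β : Type}

/-- The statement of a Turing machine that executes one instruction. -/
def stmtOf {Q : Type} : Instr Γ Q → TM2.Stmt Γ Q Q
  | .push k a q => .push k (fun _ => a) (.load (fun _ => q) (.goto id))
  | .pop k f => .pop k (fun _ o => f o) (.goto id)
  | .peek k f => .peek k (fun _ o => f o) (.goto id)
  | .jump q => .load (fun _ => q) (.goto id)

theorem stepAux_stmtOf {Q : Type} (i : Instr Γ Q) (q : Q) (S : ∀ k, List (Γ k)) :
    TM2.stepAux (stmtOf i) q S = ⟨some (i.next S), i.next S, i.act S⟩ := by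
  cases i <;> simp [stmtOf, Instr.next, Instr.act]

/-- The Turing machine that runs a program. -/
noncomputable def toTM [Fintype K] (c : Code Γ Unit) (k₀ k₁ : K) [Finite (Γ k₀)] : FinTM2 where
  K := K
  k₀ := k₀
  k₁ := k₁
  Γ := Γ
  -- The control state is kept twice, as label and as internal variable. A machine can branch on a
  -- popped symbol only through its variable, so each instruction stores the next state there and
  -- then jumps to it by `goto id`.
  Λ := c.Q ⊕ Unit
  main := c.entry
  ΛFin := Fintype.ofFinite _
  σ := c.Q ⊕ Unit
  initialState := c.entry
  σFin := Fintype.ofFinite _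
  Γk₀Fin := Fintype.ofFinite _
  -- A halting configuration must have the initial value in the internal variable, hence the reset
  -- before `halt`.
  m := Sum.elim (fun q => stmtOf (c.code q)) fun _ => .load (fun _ => c.entry) .halt

theorem initList_eq (M : FinTM2) (l : List (M.Γ M.k₀)) :
    initList M l = ⟨some M.main, M.initialState, single M.k₀ l⟩ := by
  unfold initList single
  congr 1
  funext k
  by_cases h : k = M.k₀
  · subst h; simp
  · rw [dif_neg h, Function.update_of_ne h]

theorem haltList_eq (M : FinTM2) (l : List (M.Γ M.k₁)) :
    haltList M l = ⟨none, M.initialState, single M.k₁ l⟩ := by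
  unfold haltList single
  congr 1
  funext k
  by_cases h : k = M.k₁
  · subst h; simp
  · rw [dif_neg h, Function.update_of_ne h]

theorem RunsFrom.exists_iterate [Fintype K] {c : Code Γ Unit} {k₀ k₁ : K} [Finite (Γ k₀)]
    {q S b S' t} (h : c.RunsFrom q S b S' t) :
    ∃ n ≤ t + 1, (flip Bind.bind (c.toTM k₀ k₁).step)^[n] (some (⟨some q, q, S⟩ : (c.toTM k₀ k₁).Cfg)) =
      some (⟨none, c.entry, S'⟩ : (c.toTM k₀ k₁).Cfg) := by
  induction h with
  -- The one extra machine step is the reset and halt after the program has returned.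
  | done b S t => exact ⟨1, by omega, rfl⟩
  | step q S b S' t _ ih =>
    obtain ⟨n, hn, h⟩ := ih
    refine ⟨n + 1, by omega, ?_⟩
    rw [Function.iterate_succ_apply, ← h]
    congr 1
    exact congrArg some (stepAux_stmtOf (c.code q) _ S)

/-- A function that is computed by a stack program in polynomial time is computed by a Turing
machine in polynomial time. -/
theorem polyTime [Fintype K] (c : Code Γ Unit) (k₀ k₁ : K) [Finite (Γ k₀)] {A B ΓA ΓB : Type}
    (e₀ : ΓA ≃ Γ k₀) (e₁ : Γ k₁ ≃ ΓB) {ea : A → List ΓA} {eb : B → List ΓB} {f : A → B}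
    (p : Polynomial ℕ)
    (h : ∀ a, c.Runs (single k₀ ((ea a).map e₀)) () (single k₁ ((eb (f a)).map e₁.symm))
      (p.eval (ea a).length)) :
    Nonempty (TM2ComputableInPolyTime ea eb f) := by
  choose n hn h using fun a => (h a).exists_iterate (k₀ := k₀) (k₁ := k₁)
  refine ⟨⟨⟨c.toTM k₀ k₁, e₀.symm, e₁⟩, p + 1, fun a => ⟨⟨n a, ?_⟩, ?_⟩⟩⟩
  · rw [initList_eq, Option.map_some, haltList_eq]
    exact h a
  · simpa using hn a

/-! ### From Turing machines back to stack programs. -/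

/-- The program that executes a statement of a Turing machine. -/
noncomputable def ofStmt {Λ σ : Type} [Finite σ] : TM2.Stmt Γ Λ σ → σ → Code Γ (Option Λ × σ)
  | .push k f s, v => (push k (f v)).bind fun _ => ofStmt s v
  | .peek k f s, v => (peek k (f v)).bind fun v => ofStmt s v
  | .pop k f s, v => (pop k (f v)).bind fun v => ofStmt s v
  | .load f s, v => ofStmt s (f v)
  | .branch f s s', v => bif f v then ofStmt s v else ofStmt s' v
  | .goto f, v => pure (some (f v), v)
  | .halt, v => pure (none, v)

/-- The number of instructions of a statement. -/
def stmtSize {Λ σ : Type} : TM2.Stmt Γ Λ σ → ℕ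
  | .push _ _ s => stmtSize s + 1
  | .peek _ _ s => stmtSize s + 1
  | .pop _ _ s => stmtSize s + 1
  | .load _ s => stmtSize s
  | .branch _ s s' => stmtSize s + stmtSize s'
  | .goto _ => 0
  | .halt => 0

/-- The value of the internal variable is a parameter of the program, so `load`, `branch` and `goto`
are resolved while the program is built. Only the stack operations take time. -/
theorem runs_ofStmt {Λ σ : Type} [Finite σ] (s : TM2.Stmt Γ Λ σ) (v : σ) (S : ∀ k, List (Γ k)) :
    (ofStmt s v).Runs S ((TM2.stepAux s v S).l, (TM2.stepAux s v S).var) (TM2.stepAux s v S).stk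
      (stmtSize s) := by
  induction s generalizing v S with
  | push k f s ih => exact .push_bind (ih ..)
  | peek k f s ih => exact .peek_bind (ih ..)
  | pop k f s ih => exact .pop_bind (ih ..)
  | load f s ih => exact ih ..
  | branch f s s' ih ih' =>
    simp only [ofStmt, TM2.stepAux]
    cases f v
    · exact (ih' v S).mono (Nat.le_add_left ..)
    · exact (ih v S).mono (Nat.le_add_right ..)
  | goto f => exact runs_pure ..
  | halt => exact runs_pure ..

/-- The program that runs a Turing machine. -/
noncomputable def ofTM (M : FinTM2) : Code M.Γ Unit :=
  have := M.ΛFin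
  have := M.σFin
  loop (σ := M.Λ × M.σ) (fun p => (ofStmt (M.m p.1) p.2).bind fun r =>
    pure (r.1.elim (.inr ()) fun l => .inl (l, r.2))) (M.main, M.initialState)

/-- One machine step is one pass through the loop: at most `D` stack operations and one jump. -/
theorem runs_ofTM_aux (M : FinTM2) {D : ℕ} (hD : ∀ l, stmtSize (M.m l) ≤ D) (n : ℕ) (q : M.Λ)
    (v v' : M.σ) (S S' : ∀ k, List (M.Γ k))
    (h : (flip Bind.bind M.step)^[n] (some (⟨some q, v, S⟩ : M.Cfg)) =
      some (⟨none, v', S'⟩ : M.Cfg)) :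
    have := M.ΛFin
    have := M.σFin
    (loop (σ := M.Λ × M.σ) (fun p => (ofStmt (M.m p.1) p.2).bind fun r =>
      pure (r.1.elim (.inr ()) fun l => .inl (l, r.2))) (q, v)).Runs S () S' ((D + 1) * n) := by
  have := M.ΛFin
  have := M.σFin
  -- A step after halting gives `none` for good, so a halted machine cannot have iterations left.
  have hnone : ∀ n, (flip Bind.bind M.step)^[n] none = none := fun n =>
    Function.iterate_fixed (f := flip Bind.bind M.step) rfl n
  induction n generalizing q v S with
  | zero =>
    rw [Function.iterate_zero_apply] at h
    cases h
  | succ n ih =>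
    rw [Function.iterate_succ_apply] at h
    change (flip Bind.bind M.step)^[n] (some (TM2.stepAux (M.m q) v S)) = _ at h
    have hr := (runs_ofStmt (M.m q) v S).mono (hD q)
    generalize TM2.stepAux (M.m q) v S = c at h hr
    obtain ⟨_ | l, w, T⟩ := c
    · cases n with
      | zero =>
        rw [Function.iterate_zero_apply] at h
        cases h
        exact (Runs.loop_exit hr.bind_pure).mono (by simp)
      | succ n =>
        rw [Function.iterate_succ_apply] at h
        cases (hnone n).symm.trans h
    · exact (Runs.loop_continue hr.bind_pure (ih l w T h)).mono (by ring_nf; rfl)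

theorem exists_runs_ofTM (M : FinTM2) : ∃ D : ℕ, ∀ l l' t, TM2OutputsInTime M l (some l') t →
    (ofTM M).Runs (single M.k₀ l) () (single M.k₁ l') (D * t) := by
  have := M.ΛFin
  refine ⟨(Finset.univ.sup fun l => stmtSize (M.m l)) + 1, fun l l' t h => ?_⟩
  obtain ⟨⟨n, h⟩, hn⟩ := h
  rw [initList_eq, Option.map_some, haltList_eq] at h
  change n ≤ t at hn
  exact (runs_ofTM_aux M (fun l => Finset.le_sup (f := fun l => stmtSize (M.m l))
    (Finset.mem_univ l)) n _ _ _ _ _ h).mono (Nat.mul_le_mul_left _ hn)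

/-- A function that is computed by a Turing machine in polynomial time is computed by a stack
program in polynomial time. -/
theorem exists_of_polyTime {A B ΓA ΓB : Type} {ea : A → List ΓA} {eb : B → List ΓB} {f : A → B}
    (h : TM2ComputableInPolyTime ea eb f) :
    ∃ (M : FinTM2) (e₀ : ΓA ≃ M.Γ M.k₀) (e₁ : M.Γ M.k₁ ≃ ΓB) (p : Polynomial ℕ), ∀ a,
      (ofTM M).Runs (single M.k₀ ((ea a).map e₀)) () (single M.k₁ ((eb (f a)).map e₁.symm))
        (p.eval (ea a).length) := by
  obtain ⟨⟨M, e₀, e₁⟩, p, h⟩ := h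
  obtain ⟨D, hD⟩ := exists_runs_ofTM M
  refine ⟨M, e₀.symm, e₁, Polynomial.C D * p, fun a => ?_⟩
  rw [Polynomial.eval_mul, Polynomial.eval_C]
  exact hD _ _ _ (h a)

end Code
end StackProgram

/-! ### Composition of polynomial-time functions -/

namespace StackProgram

open Function (update update_of_ne update_self update_eq_self update_comm
  update_idem)
open Turing

namespace Code

variable {K : Type} [DecidableEq K] {Γ : K → Type} {β : Type}

/-- Move the contents of the stack `k` to the stack `k'`, in reverse order. -/
def move (k k' : K) [Finite (Γ k)] (g : Γ k → Γ k') : Code Γ Unit :=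
  loop (σ := Unit) (fun _ => (pop k id).bind fun o =>
    o.elim (pure (.inr ())) fun a => (push k' (g a)).bind fun _ => pure (.inl ())) ()

/-- Each symbol costs a jump, a pop and a push; the last, failing attempt costs a jump and a pop. -/
theorem runs_move {k k' : K} [Finite (Γ k)] (hk : k ≠ k') (g : Γ k → Γ k')
    (R : ∀ k, List (Γ k)) (l : List (Γ k)) (l' : List (Γ k')) :
    (move k k' g).Runs (update (update R k l) k' l') ()
      (update (update R k []) k' ((l.map g).reverse ++ l')) (3 * l.length + 2) := by
  induction l generalizing l' with
  | nil =>
    refine Runs.loop_exit (t := 1) (.pop_bind ?_)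
    have e : update (update (update R k []) k' l') k [] = update (update R k []) k' l' := by
      rw [update_comm hk.symm, update_idem]
    rw [update_of_ne hk, update_self, List.tail_nil, e]
    exact runs_pure ..
  | cons a l ih =>
    refine (Runs.loop_continue (t := 2) (t' := 3 * l.length + 2)
      (S' := update (update R k l) k' (g a :: l')) (s' := ()) (.pop_bind ?_) ?_).mono ?_
    · have e : update (update (update R k (a :: l)) k' l') k l = update (update R k l) k' l' := by
        rw [update_comm hk.symm, update_idem]
      rw [update_of_ne hk, update_self, List.tail_cons, e]
      refine .push_bind ?_
      rw [update_self, update_idem]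
      exact runs_pure ..
    · simp only [List.map_cons, List.reverse_cons, List.append_assoc, List.singleton_append]
      exact ih (g a :: l')
    · simp only [List.length_cons]; omega

theorem runs_move_single {k k' : K} [Finite (Γ k)] (hk : k ≠ k') (g : Γ k → Γ k')
    {l : List (Γ k)} {l' : List (Γ k')} (hl : (l.map g).reverse = l')
    {n : ℕ} (hn : l.length ≤ n) :
    (move k k' g).Runs (single k l) () (single k' l') (3 * n + 2) := by
  subst hl
  refine Runs.mono (t := 3 * l.length + 2) ?_ (by omega)
  have := runs_move hk g (fun _ => []) l []
  rw [List.append_nil] at this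
  unfold single
  convert this using 1
  · funext j
    rcases eq_or_ne j k' with rfl | hj
    · simp [hk.symm]
    · simp [hj]
  · congr 1
    exact (update_eq_self k (fun _ => [])).symm

theorem Runs.lift_update {K' : Type} [DecidableEq K'] {Γ' : K' → Type} {ι : K → K'}
    (hι : Function.Injective ι) {c : Code (fun k => Γ' (ι k)) β} {k k' : K}
    {l : List (Γ' (ι k))} {l' : List (Γ' (ι k'))} {b t}
    (h : c.Runs (single k l) b (single k' l') t) {R : ∀ k, List (Γ' k)} (hR : ∀ j, R (ι j) = []) :
    (c.lift ι).Runs (update R (ι k) l) b (update R (ι k') l') t := by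
  have e (k : K) (l : List (Γ' (ι k))) (j : K) :
      update R (ι k) l (ι j) = single (Γ := fun k => Γ' (ι k)) k l j := by
    unfold single
    rcases eq_or_ne j k with rfl | hj
    · simp
    · rw [update_of_ne hj, update_of_ne (hι.ne hj), hR]
  refine h.lift hι (e _ _) (e _ _) fun j hj => ?_
  rw [update_of_ne fun h => hj ⟨_, h.symm⟩, update_of_ne fun h => hj ⟨_, h.symm⟩]

theorem Runs.lift_single {K' : Type} [DecidableEq K'] {Γ' : K' → Type} {ι : K → K'}
    (hι : Function.Injective ι) {c : Code (fun k => Γ' (ι k)) β} {k k' : K}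
    {l : List (Γ' (ι k))} {l' : List (Γ' (ι k'))} {b t}
    (h : c.Runs (single k l) b (single k' l') t) :
    (c.lift ι).Runs (single (ι k) l) b (single (ι k') l') t :=
  h.lift_update hι fun _ => rfl

end Code

theorem eval_mono (p : Polynomial ℕ) {m n : ℕ} (h : m ≤ n) : p.eval m ≤ p.eval n := by
  simp only [Polynomial.eval_eq_sum]
  exact Finset.sum_le_sum fun i _ => Nat.mul_le_mul_left _ (Nat.pow_le_pow_left h i)

open Code in
/-- The composition of two functions that are computed in polynomial time. -/
theorem comp_polyTime {A B C ΓA ΓB ΓC : Type} [Finite ΓA] [Finite ΓB] {ea : A → List ΓA}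
    {eb : B → List ΓB} {ec : C → List ΓC} {f : A → B} {g : B → C}
    (hf : Nonempty (TM2ComputableInPolyTime ea eb f))
    (hg : Nonempty (TM2ComputableInPolyTime eb ec g)) :
    Nonempty (TM2ComputableInPolyTime ea ec (g ∘ f)) := by
  obtain ⟨M, e₀, e₁, p, hM⟩ := exists_of_polyTime hf.some
  obtain ⟨N, d₀, d₁, q, hN⟩ := exists_of_polyTime hg.some
  have : Fintype M.K := M.kFin
  have : Fintype N.K := N.kFin
  -- A move reverses the string. The output of `M` therefore passes through one extra stack, and two
  -- moves bring it to `N` in the original order.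
  let Γ : M.K ⊕ (N.K ⊕ Unit) → Type := Sum.elim M.Γ (Sum.elim N.Γ fun _ => ΓB)
  have : Finite (Γ (.inl M.k₁)) := .of_equiv _ e₁.symm
  have : Finite (Γ (.inl M.k₀)) := .of_equiv _ e₀
  have : Finite (Γ (.inr (.inr ()))) := inferInstanceAs (Finite ΓB)
  let c : Code Γ Unit :=
    (lift (Γ' := Γ) Sum.inl (ofTM M)).bind fun _ =>
    (move (Γ := Γ) (.inl M.k₁) (.inr (.inr ())) e₁).bind fun _ =>
    (move (Γ := Γ) (.inr (.inr ())) (.inr (.inl N.k₀)) d₀).bind fun _ =>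
    lift (Γ' := Γ) (Sum.inr ∘ Sum.inl) (ofTM N)
  refine polyTime c (.inl M.k₀) (.inr (.inl N.k₁)) e₀ d₁
    (p + 6 * (Polynomial.X + p) + 4 + q.comp (Polynomial.X + p)) fun a => ?_
  -- A step pushes at most one symbol, so the intermediate string is no longer than the input plus
  -- the running time of `M`.
  have hlen : (eb (f a)).length ≤ (ea a).length + p.eval (ea a).length := by
    have := (hM a).length_le M.k₁
    refine (by simpa [single] using this : _ ≤ _).trans (Nat.add_le_add_right ?_ _)
    by_cases h : M.k₁ = M.k₀
    · rw [h]; simp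
    · rw [update_of_ne h]; simp
  have h1 := (hM a).lift_single (Γ' := Γ) (ι := Sum.inl) Sum.inl_injective
  have h2 := runs_move_single (Γ := Γ) (k := .inl M.k₁) (k' := .inr (.inr ())) (by simp) e₁
    (l := (eb (f a)).map e₁.symm) (l' := (eb (f a)).reverse)
    (congrArg List.reverse (by simp : ((eb (f a)).map e₁.symm).map e₁ = eb (f a)))
    (n := (eb (f a)).length) (List.length_map ..).le
  have h3 := runs_move_single (Γ := Γ) (k := .inr (.inr ())) (k' := .inr (.inl N.k₀)) (by simp) d₀
    (l := (eb (f a)).reverse) (l' := (eb (f a)).map d₀)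
    (by simp : ((eb (f a)).reverse.map d₀).reverse = (eb (f a)).map d₀)
    (n := (eb (f a)).length) List.length_reverse.le
  have h4 := (hN (f a)).lift_single (Γ' := Γ) (ι := Sum.inr ∘ Sum.inl)
    (Sum.inr_injective.comp Sum.inl_injective)
  refine (h1.bind (h2.bind (h3.bind h4))).mono ?_
  have := eval_mono q hlen
  simp only [Polynomial.eval_add, Polynomial.eval_mul,
    Polynomial.eval_comp, Polynomial.eval_X, Polynomial.eval_ofNat]
  simp only [Function.comp] at *
  omega

end StackProgram

/-! ### The extension of an instance by one vertex and one color -/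

namespace FairInstance

open Computability (Γ' encodeNat)

/-- The profits after the addition of a vertex, and of a color for which only this vertex has a
profit, namely `q`. -/
def extendProfit {k n : ℕ} (p : Fin k → Fin n → ℕ) (q : ℕ) : Fin (k + 1) → Fin (n + 1) → ℕ :=
  Fin.snoc (α := fun _ => Fin (n + 1) → ℕ) (fun j => Fin.snoc (α := fun _ => ℕ) (p j) 0)
    (Fin.snoc (α := fun _ => ℕ) (fun _ => 0) q)

section

variable {k n : ℕ} (p : Fin k → Fin n → ℕ) (q : ℕ) (j : Fin k) (v : Fin n)

@[simp] theorem extendProfit_castSucc_castSucc :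
    extendProfit p q j.castSucc v.castSucc = p j v := by simp [extendProfit]

@[simp] theorem extendProfit_castSucc_last :
    extendProfit p q j.castSucc (Fin.last n) = 0 := by simp [extendProfit]

@[simp] theorem extendProfit_last_castSucc :
    extendProfit p q (Fin.last k) v.castSucc = 0 := by simp [extendProfit]

@[simp] theorem extendProfit_last_last :
    extendProfit p q (Fin.last k) (Fin.last n) = q := by simp [extendProfit]

/-- The lists of profits, as a string. -/
def profitString (p : Fin k → Fin n → ℕ) : List Γ' :=
  (List.finRange k).flatMap fun j =>
    (List.finRange n).flatMap (fun v => encodeNumber (p j v)) ++ [Γ'.ket]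

theorem ket_notMem_encodeGraph (G : FinGraph) : Γ'.ket ∉ encodeGraph G := by
  simp [encodeGraph]

theorem ket_notMem_row (l : List (Fin n)) :
    Γ'.ket ∉ l.flatMap fun v => encodeNumber (p j v) := by
  simp [encodeNumber]

/-- Insert a comma before each row separator. -/
def padRow (g : Γ') : List Γ' := if g = Γ'.ket then [Γ'.comma, Γ'.ket] else [g]

theorem flatMap_padRow {l : List Γ'} (hl : Γ'.ket ∉ l) : l.flatMap padRow = l := by
  induction l with
  | nil => rfl
  | cons g l ih =>
    simp only [List.mem_cons, not_or] at hl
    rw [List.flatMap_cons, ih hl.2, padRow, if_neg (Ne.symm hl.1), List.singleton_append]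

theorem encodeNumber_zero : encodeNumber 0 = [Γ'.comma] := rfl

/-- Zero has no binary digits and is encoded by a lone comma. An old row thus gains a comma before
its separator, and the new row consists of `n` commas followed by the code of `q`. This form makes
the edit a one-pass string operation. -/
theorem profitString_extendProfit : profitString (extendProfit p q) =
    (profitString p).flatMap padRow ++
      (List.replicate n Γ'.comma ++ (encodeNumber q ++ [Γ'.ket])) := by
  rw [profitString, List.finRange_succ_last (n := k), List.flatMap_append, profitString,
    List.flatMap_assoc]
  congr 1
  · rw [List.flatMap_map]
    congr 1
    funext j
    rw [List.finRange_succ_last, List.flatMap_append, List.flatMap_map, List.flatMap_append,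
      flatMap_padRow (ket_notMem_row p j _)]
    simp [encodeNumber_zero, padRow]
  · rw [List.finRange_succ_last]
    have : (List.finRange n).flatMap (fun _ => [Γ'.comma]) = List.replicate n Γ'.comma := by
      rw [List.eq_replicate_iff]
      simp [List.length_flatMap]
    simp [List.flatMap_map, encodeNumber_zero, this]

/-- The assumption `1 ≤ k` matters: in `ℕ` the infimum over no colors is `0`. -/
theorem le_satisfactionLevel {G : SimpleGraph (Fin n)} (hk : 1 ≤ k) (c : PartialColoring G k) :
    q ≤ c.satisfactionLevel p ↔ ∀ j, q ≤ ∑ v ∈ c.X j, p j v := by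
  have : Nonempty (Fin k) := ⟨⟨0, hk⟩⟩
  exact le_ciInf_iff (OrderBot.bddBelow _)

/-- Correctness of the reduction. The new vertex is worthless to the old colors, so forgetting it
loses no profit; alone, it satisfies the new color exactly. -/
theorem exists_coloring_extendProfit_iff (hk : 1 ≤ k) {G : SimpleGraph (Fin n)}
    {H : SimpleGraph (Fin (n + 1))} (h : H.comap Fin.castSucc = G) :
    (∃ c : PartialColoring H (k + 1), q ≤ c.satisfactionLevel (extendProfit p q)) ↔
      ∃ c : PartialColoring G k, q ≤ c.satisfactionLevel p := by
  subst h
  constructor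
  · rintro ⟨c, hc⟩
    rw [le_satisfactionLevel _ _ (by omega)] at hc
    refine ⟨⟨fun j => Finset.univ.filter fun v => v.castSucc ∈ c.X j.castSucc, ?_, ?_⟩, ?_⟩
    · intro i j hij
      rw [Finset.disjoint_left]
      intro v hi hj
      simp only [Finset.mem_filter_univ] at hi hj
      exact Finset.disjoint_left.1 (c.disjoint (by simpa using hij)) hi hj
    · intro j u hu v hv huv
      simp only [Finset.coe_filter_univ, Set.mem_ofPred_eq] at hu hv
      rw [SimpleGraph.comap_adj]
      exact c.indep j.castSucc hu hv (fun e => huv (Fin.castSucc_injective _ e))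
    · rw [le_satisfactionLevel _ _ hk]
      intro j
      refine (hc j.castSucc).trans_eq ?_
      -- Both sums are written over all vertices; the term of the new vertex is zero.
      rw [← Finset.univ_inter (c.X j.castSucc), ← Finset.sum_ite_mem, Fin.sum_univ_castSucc,
        Finset.sum_filter]
      simp
  · rintro ⟨c, hc⟩
    rw [le_satisfactionLevel _ _ hk] at hc
    refine ⟨⟨Fin.snoc (α := fun _ => Finset (Fin (n + 1)))
      (fun j => (c.X j).map Fin.castSuccEmb) {Fin.last n}, ?_, ?_⟩, ?_⟩
    · have hd (j : Fin k) : Disjoint ((c.X j).map Fin.castSuccEmb) {Fin.last n} := by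
        simp [Finset.disjoint_left]
      intro i j hij
      induction i using Fin.lastCases with
      | last =>
        induction j using Fin.lastCases with
        | last => exact absurd rfl hij
        | cast j => simpa only [Fin.snoc_castSucc, Fin.snoc_last] using (hd j).symm
      | cast i =>
        induction j using Fin.lastCases with
        | last => simpa only [Fin.snoc_castSucc, Fin.snoc_last] using hd i
        | cast j =>
          simp only [Fin.snoc_castSucc, Finset.disjoint_map]
          exact c.disjoint (by simpa using hij)
    · intro j
      induction j using Fin.lastCases with
      | last => simp [SimpleGraph.IsIndepSet]
      | cast j =>
        intro u hu v hv huv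
        simp only [Fin.snoc_castSucc, Finset.coe_map, Set.mem_image, Finset.mem_coe] at hu hv
        obtain ⟨u, hu, rfl⟩ := hu
        obtain ⟨v, hv, rfl⟩ := hv
        exact c.indep j hu hv (fun e => huv (congrArg _ e))
    · rw [le_satisfactionLevel _ _ (by omega)]
      intro j
      induction j using Fin.lastCases with
      | last => simp
      | cast j => simpa using hc j

end

variable {k : ℕ} {𝒢 : GraphClass} (I : FairInstance k 𝒢)

theorem encode_eq : I.encode =
    encodeGraph ⟨I.n, I.graph⟩ ++ Γ'.ket :: (encodeNumber I.q ++ profitString I.profit) :=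
  rfl

/-- Add a vertex, and a color for which only this vertex has a profit. -/
def extend (H : SimpleGraph (Fin (I.n + 1))) (hH : 𝒢.Mem H) : FairInstance (k + 1) 𝒢 where
  n := I.n + 1
  graph := H
  mem := hH
  profit := extendProfit I.profit I.q
  q := I.q

variable {H : SimpleGraph (Fin (I.n + 1))} (hH : 𝒢.Mem H)

theorem profit_le_maxNum (j : Fin k) (v : Fin I.n) : I.profit j v ≤ I.maxNum :=
  le_max_of_le_right ((Finset.le_sup (f := fun v => I.profit j v) (Finset.mem_univ v)).trans
    (Finset.le_sup (f := fun j => Finset.univ.sup fun v => I.profit j v) (Finset.mem_univ j)))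

/-- The only new profits are `0` and `q`, and `q` already counts as a number of the instance. -/
theorem maxNum_extend_le : (I.extend H hH).maxNum ≤ I.maxNum := by
  refine max_le (le_max_left _ _) (Finset.sup_le fun j _ => Finset.sup_le fun v _ => ?_)
  change extendProfit I.profit I.q j v ≤ _
  change Fin (I.n + 1) at v
  induction j using Fin.lastCases with
  | last =>
    induction v using Fin.lastCases with
    | last => simp [maxNum]
    | cast v => simp
  | cast j =>
    induction v using Fin.lastCases with
    | last => simp
    | cast v => simpa using I.profit_le_maxNum j v

/-- For the strong version the numbers must be polynomial in the length of the new instance, so that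
length must not drop. -/
theorem length_encode_le_extend : I.encode.length ≤ (I.extend H hH).encode.length := by
  have hg (G : FinGraph) : (encodeGraph G).length = G.1 * (G.1 + 1) := by
    simp [encodeGraph, List.length_flatMap]
  have hp (l : List Γ') : l.length ≤ (l.flatMap padRow).length := by
    rw [List.length_flatMap]
    induction l with
    | nil => rfl
    | cons g l ih =>
      have : 1 ≤ (padRow g).length := by unfold padRow; split <;> simp
      simp only [List.length_cons, List.map_cons, List.sum_cons]
      omega
  have h1 := hp (profitString I.profit)
  have h2 : I.n * (I.n + 1) ≤ (I.n + 1) * (I.n + 1 + 1) :=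
    Nat.mul_le_mul (by omega) (by omega)
  simp only [encode_eq, extend, profitString_extendProfit, List.length_append, List.length_cons, hg]
  omega

theorem yes_extend_iff (hk : 1 ≤ k) (h : H.comap Fin.castSucc = I.graph) :
    (fairDivision (k + 1) 𝒢).Yes (I.extend H hH) ↔ (fairDivision k 𝒢).Yes I :=
  exists_coloring_extendProfit_iff I.profit I.q hk h

end FairInstance

/-! ### The program of the reduction -/

namespace StackProgram

open Function (update update_self update_of_ne)
open Computability (Γ')
open FairInstance (padRow)
open Turing

namespace Code

/-! ### Stacks of a subroutine next to stacks of the main program. -/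

/-- States of two disjoint families of stacks. -/
def join {K L : Type} {Γ : K → Type} {Δ : L → Type} (S : ∀ k, List (Γ k)) (T : ∀ l, List (Δ l)) :
    ∀ k, List (Sum.elim Γ Δ k)
  | .inl k => S k
  | .inr l => T l

theorem join_nil {K L : Type} {Γ : K → Type} {Δ : L → Type} :
    (fun _ => [] : ∀ k, List (Sum.elim Γ Δ k)) = join (fun _ => []) fun _ => [] := by
  funext j
  cases j <;> rfl

section join

variable {K L : Type} [DecidableEq K] [DecidableEq L] {Γ : K → Type} {Δ : L → Type} {β : Type}

@[simp] theorem update_join_inl (S : ∀ k, List (Γ k)) (T : ∀ l, List (Δ l)) (k : K)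
    (l : List (Γ k)) : update (join S T) (.inl k) l = join (update S k l) T := by
  funext j
  rcases j with j | j
  · change _ = update S k l j
    rcases eq_or_ne j k with rfl | h
    · exact (update_self (f := join S T) (.inl j) l).trans (update_self j l S).symm
    · exact (update_of_ne (by simpa using h) _ _).trans (update_of_ne h _ _).symm
  · exact update_of_ne Sum.inr_ne_inl _ _

@[simp] theorem update_join_inr (S : ∀ k, List (Γ k)) (T : ∀ l, List (Δ l)) (k : L)
    (l : List (Δ k)) : update (join S T) (.inr k) l = join S (update T k l) := by
  funext j
  rcases j with j | j
  · exact update_of_ne Sum.inl_ne_inr _ _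
  · change _ = update T k l j
    rcases eq_or_ne j k with rfl | h
    · exact (update_self (f := join S T) (.inr j) l).trans (update_self j l T).symm
    · exact (update_of_ne (by simpa using h) _ _).trans (update_of_ne h _ _).symm

theorem single_inr (k : L) (l : List (Δ k)) :
    single (Γ := Sum.elim Γ Δ) (.inr k) l = join (fun _ => []) (single k l) :=
  (congrArg
    (fun X : ∀ j, List (Sum.elim Γ Δ j) => update X (.inr k) (l : List (Δ k))) join_nil).trans
    (update_join_inr _ _ k l)

theorem Runs.lift_inl {c : Code Γ β} {S b S' t} (h : c.Runs S b S' t) (T : ∀ l, List (Δ l)) :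
    (Code.lift (Γ' := Sum.elim Γ Δ) Sum.inl c).Runs (join S T) b (join S' T) t :=
  h.lift (Γ' := Sum.elim Γ Δ) Sum.inl_injective (fun _ => rfl) (fun _ => rfl) fun k hk => by
    rcases k with k | k
    · exact absurd ⟨k, rfl⟩ hk
    · rfl

theorem Runs.lift_inr {c : Code Δ β} {T b T' t} (h : c.Runs T b T' t) (S : ∀ k, List (Γ k)) :
    (Code.lift (Γ' := Sum.elim Γ Δ) Sum.inr c).Runs (join S T) b (join S T') t :=
  h.lift (Γ' := Sum.elim Γ Δ) Sum.inr_injective (fun _ => rfl) (fun _ => rfl) fun k hk => by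
    rcases k with k | k
    · rfl
    · exact absurd ⟨k, rfl⟩ hk

end join

theorem runs_move_of_eq {K : Type} [DecidableEq K] {Γ : K → Type} {k k' : K} [Finite (Γ k)]
    (hk : k ≠ k') (g : Γ k → Γ k') {S S' : ∀ k, List (Γ k)} {n : ℕ}
    (hS : update (update S k []) k' (((S k).map g).reverse ++ S k') = S')
    (hn : (S k).length ≤ n) : (move k k' g).Runs S () S' (3 * n + 2) := by
  have := runs_move hk g S (S k) (S k')
  rw [Function.update_eq_self, Function.update_eq_self, hS] at this
  exact this.mono (by omega)

section join

variable {K L : Type} [DecidableEq K] [DecidableEq L] {Γ : K → Type} {Δ : L → Type}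
  {S S' : ∀ k, List (Γ k)} {T T' : ∀ k, List (Δ k)} {k : K} {l : L} {n : ℕ}

theorem runs_move_inr_inl [Finite (Sum.elim Γ Δ (.inr l))] (g : Δ l → Γ k)
    (hS : update S k (((T l).map g).reverse ++ S k) = S') (hT : update T l [] = T')
    (hn : (T l).length ≤ n) :
    (move (Γ := Sum.elim Γ Δ) (.inr l) (.inl k) g).Runs (join S T) () (join S' T') (3 * n + 2) :=
  runs_move_of_eq (Γ := Sum.elim Γ Δ) Sum.inr_ne_inl g
    ((congrArg (fun X : ∀ j, List (Sum.elim Γ Δ j) => update X (.inl k)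
      (((T l).map g).reverse ++ S k : List (Γ k)))
      (update_join_inr S T l [])).trans ((update_join_inl _ _ k _).trans (by rw [hS, hT]))) hn

theorem runs_move_inl_inr [Finite (Sum.elim Γ Δ (.inl k))] (g : Γ k → Δ l)
    (hT : update T l (((S k).map g).reverse ++ T l) = T') (hS : update S k [] = S')
    (hn : (S k).length ≤ n) :
    (move (Γ := Sum.elim Γ Δ) (.inl k) (.inr l) g).Runs (join S T) () (join S' T') (3 * n + 2) :=
  runs_move_of_eq (Γ := Sum.elim Γ Δ) Sum.inl_ne_inr g
    ((congrArg (fun X : ∀ j, List (Sum.elim Γ Δ j) => update X (.inr l)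
      (((S k).map g).reverse ++ T l : List (Δ l)))
      (update_join_inl S T k [])).trans ((update_join_inr _ _ l _).trans (by rw [hS, hT]))) hn

end join

end Code

/-! ### Editing the bound and the profit lists. -/

namespace Extend

/-- The names of the stacks. -/
inductive Name
  | input
  | temp
  | count
  | number
  | result
  | output
  deriving DecidableEq

instance : Fintype Name :=
  ⟨{.input, .temp, .count, .number, .result, .output}, fun k => by cases k <;> decide⟩

/-- The contents of the stacks. -/
structure Stacks where
  input : List Γ'
  temp : List Γ'
  count : List Γ'
  number : List Γ'
  result : List Γ'
  output : List Γ'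

namespace Stacks

/-- The contents of a stack. -/
def get (s : Stacks) : Name → List Γ'
  | .input => s.input
  | .temp => s.temp
  | .count => s.count
  | .number => s.number
  | .result => s.result
  | .output => s.output

variable (s : Stacks) (l : List Γ')

@[simp] theorem get_input : s.get .input = s.input := rfl
@[simp] theorem get_temp : s.get .temp = s.temp := rfl
@[simp] theorem get_count : s.get .count = s.count := rfl
@[simp] theorem get_number : s.get .number = s.number := rfl
@[simp] theorem get_result : s.get .result = s.result := rfl
@[simp] theorem get_output : s.get .output = s.output := rfl

@[simp] theorem update_input : update s.get .input l = { s with input := l }.get := by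
  funext j; cases j <;> rfl
@[simp] theorem update_temp : update s.get .temp l = { s with temp := l }.get := by
  funext j; cases j <;> rfl
@[simp] theorem update_count : update s.get .count l = { s with count := l }.get := by
  funext j; cases j <;> rfl
@[simp] theorem update_number : update s.get .number l = { s with number := l }.get := by
  funext j; cases j <;> rfl
@[simp] theorem update_result : update s.get .result l = { s with result := l }.get := by
  funext j; cases j <;> rfl
@[simp] theorem update_output : update s.get .output l = { s with output := l }.get := by
  funext j; cases j <;> rfl

end Stacks

open Code

/-- Programs on these stacks. -/
abbrev Prog (β : Type) : Type 1 := Code (fun _ : Name => Γ') β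

/-- Move the input up to the first `ket` to the stack `temp`. -/
def split : Prog Unit :=
  loop (σ := Unit) (fun _ => (pop .input id).bind fun
    | none => pure (.inr ())
    | some .ket => pure (.inr ())
    | some g => (push .temp g).bind fun _ => pure (.inl ())) ()

theorem runs_split (s : Stacks) (l r : List Γ') (hl : Γ'.ket ∉ l) :
    split.Runs { s with input := l ++ Γ'.ket :: r }.get ()
      { s with input := r, temp := l.reverse ++ s.temp }.get (3 * l.length + 2) := by
  induction l generalizing s with
  | nil => exact Runs.loop_exit (t := 1) (.pop_bind (by simpa using runs_pure ..))
  | cons g l ih =>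
    simp only [List.mem_cons, not_or] at hl
    refine (Runs.loop_continue (t := 2) (t' := 3 * l.length + 2) (s' := ())
      (S' := { s with input := l ++ Γ'.ket :: r, temp := g :: s.temp }.get) (.pop_bind ?_) ?_).mono ?_
    · cases g
      case ket => exact absurd rfl hl.1
      all_goals exact .push_bind (by simpa using runs_pure ..)
    · have := ih { s with temp := g :: s.temp } hl.2
      simp only [List.reverse_cons, List.append_assoc, List.singleton_append]
      exact this
    · simp only [List.length_cons]; omega

/-- Copy a number from the input to the stacks `result` and `number`. -/
def copyNumber : Prog Unit :=
  loop (σ := Unit) (fun _ => (pop .input id).bind fun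
    | some (.bit b) => (push .result (.bit b)).bind fun _ => (push .number (.bit b)).bind fun _ =>
        pure (.inl ())
    | _ => (push .result .comma).bind fun _ => (push .number .comma).bind fun _ => pure (.inr ())) ()

/-- The number is `q`. It is needed twice: as the bound of the new instance, and later as the profit
of the new vertex. -/
theorem runs_copyNumber (s : Stacks) (a : List Bool) (r : List Γ') :
    copyNumber.Runs { s with input := a.map Γ'.bit ++ Γ'.comma :: r }.get ()
      { s with
        input := r
        result := Γ'.comma :: (a.map Γ'.bit).reverse ++ s.result
        number := Γ'.comma :: (a.map Γ'.bit).reverse ++ s.number }.get (4 * a.length + 4) := by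
  induction a generalizing s with
  | nil =>
    exact Runs.loop_exit (t := 3) (.pop_bind (.push_bind (.push_bind (by simpa using runs_pure ..))))
  | cons b a ih =>
    refine (Runs.loop_continue (t := 3) (t' := 4 * a.length + 4) (s' := ())
      (S' := { s with
        input := a.map Γ'.bit ++ Γ'.comma :: r
        result := Γ'.bit b :: s.result
        number := Γ'.bit b :: s.number }.get) (.pop_bind ?_) ?_).mono ?_
    · exact .push_bind (.push_bind (by simpa using runs_pure ..))
    · have := ih { s with result := Γ'.bit b :: s.result, number := Γ'.bit b :: s.number }
      simp only [List.map_cons, List.reverse_cons, List.append_assoc, List.cons_append,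
        List.nil_append] at this ⊢
      exact this
    · simp only [List.length_cons]; omega

/-- Copy the rows of profits from the input to the stack `result`, with a comma added to each of
them, and the commas of the first row to the stack `count`. -/
def copyRows (first : Bool) : Prog Unit :=
  loop (σ := Bool) (fun first => (pop .input id).bind fun
    | none => pure (.inr ())
    | some .ket => (push .result .comma).bind fun _ => (push .result .ket).bind fun _ =>
        pure (.inl false)
    | some .comma => (push .result .comma).bind fun _ =>
        if first then (push .count .comma).bind fun _ => pure (.inl first) else pure (.inl first)
    | some g => (push .result g).bind fun _ => pure (.inl first)) first

/-- The commas before the first `ket`, if `first` is true. -/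
def commas : Bool → List Γ' → List Γ'
  | _, [] => []
  | _, Γ'.ket :: l => commas false l
  | first, Γ'.comma :: l => (if first then [Γ'.comma] else []) ++ commas first l
  | first, _ :: l => commas first l

theorem runs_copyRows (s : Stacks) (first : Bool) (l : List Γ') :
    (copyRows first).Runs
      { s with input := l }.get ()
      { s with
        input := []
        result := (l.flatMap padRow).reverse ++ s.result
        count := (commas first l).reverse ++ s.count }.get (4 * l.length + 2) := by
  induction l generalizing s first with
  | nil => exact Runs.loop_exit (t := 1) (.pop_bind (by simpa [commas] using runs_pure ..))
  | cons g l ih =>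
    refine (Runs.loop_continue (t := 3) (t' := 4 * l.length + 2)
      (s' := if g = Γ'.ket then false else first)
      (S' := { s with
        input := l
        result := (padRow g).reverse ++ s.result
        count := (if g = Γ'.comma ∧ first then [Γ'.comma] else []) ++ s.count }.get)
      (.pop_bind ?_) ?_).mono ?_
    · cases g
      case ket => exact .push_bind (.push_bind (by simpa [padRow] using runs_pure ..))
      case comma =>
        refine .push_bind ?_
        cases first
        · simpa [padRow] using runs_pure ..
        · exact .push_bind (by simpa [padRow] using runs_pure ..)
      all_goals exact .push_bind (by simpa [padRow] using runs_pure ..)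
    · have hc : (commas first (g :: l)).reverse ++ s.count =
          (commas (if g = Γ'.ket then false else first) l).reverse ++
            ((if g = Γ'.comma ∧ first then [Γ'.comma] else []) ++ s.count) := by
        cases g <;> cases first <;> simp [commas]
      rw [hc, List.flatMap_cons, List.reverse_append, List.append_assoc]
      exact ih { s with
        result := (padRow g).reverse ++ s.result
        count := (if g = Γ'.comma ∧ first then [Γ'.comma] else []) ++ s.count }
        (if g = Γ'.ket then false else first)
    · simp only [List.length_cons]; omega

theorem commas_false (l : List Γ') : commas false l = [] := by
  induction l with
  | nil => rfl
  | cons g l ih => cases g <;> simp [commas, ih]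

theorem length_commas_le (first : Bool) (l : List Γ') : (commas first l).length ≤ l.length := by
  induction l generalizing first with
  | nil => simp [commas]
  | cons g l ih =>
    cases g
    case comma => cases first <;> simp [commas] <;> have := ih <;> grind
    all_goals exact (ih _).trans (Nat.le_succ _)

theorem length_flatMap_padRow_le (l : List Γ') : (l.flatMap padRow).length ≤ 2 * l.length := by
  induction l with
  | nil => simp
  | cons g l ih =>
    have : (padRow g).length ≤ 2 := by unfold padRow; split <;> simp
    simp only [List.flatMap_cons, List.length_append, List.length_cons]
    omega

theorem commas_encodeNumber (a : ℕ) (r : List Γ') :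
    commas true (encodeNumber a ++ r) = Γ'.comma :: commas true r := by
  unfold encodeNumber
  induction Computability.encodeNat a with
  | nil => simp [commas]
  | cons b l ih => simpa [commas] using ih

/-- Each number ends with exactly one comma, so the commas of the first row give `n` in unary and
serve as the `n` zeros of the new row. A first row exists because `1 ≤ k`. -/
theorem commas_profitString {k n : ℕ} (hk : 1 ≤ k) (p : Fin k → Fin n → ℕ) :
    commas true (FairInstance.profitString p) = List.replicate n Γ'.comma := by
  obtain ⟨k, rfl⟩ := Nat.exists_eq_add_of_le' hk
  have h (l : List (Fin n)) (r : List Γ') :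
      commas true (l.flatMap (fun v => encodeNumber (p 0 v)) ++ Γ'.ket :: r) =
        List.replicate l.length Γ'.comma := by
    induction l with
    | nil => simp [commas, commas_false]
    | cons v l ih =>
      rw [List.flatMap_cons, List.append_assoc, commas_encodeNumber, ih]
      rfl
  rw [FairInstance.profitString, List.finRange_succ, List.flatMap_cons, List.append_assoc,
    List.singleton_append, h, List.length_finRange]

/-- Assemble the output from the new graph and the rest of the input. -/
def finish : Prog Unit :=
  (push .result .ket).bind fun _ => copyNumber.bind fun _ => (copyRows true).bind fun _ =>
  (move .count .result id).bind fun _ => (move .number .temp id).bind fun _ =>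
  (move .temp .result id).bind fun _ => (push .result .ket).bind fun _ =>
  move .result .output id

/-- The output is assembled in reverse on `result`, beginning with the reversed new graph `R`, and
the final move turns it around. -/
theorem runs_finish (a : List Bool) (r R : List Γ') :
    finish.Runs (Stacks.get ⟨a.map Γ'.bit ++ Γ'.comma :: r, [], [], [], R, []⟩) ()
      (Stacks.get ⟨[], [], [], [], [], R.reverse ++ Γ'.ket :: (a.map Γ'.bit ++ [Γ'.comma] ++
        (r.flatMap padRow ++ ((commas true r).reverse ++ (a.map Γ'.bit ++ [Γ'.comma] ++ [Γ'.ket]))))⟩)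
      (3 * R.length + 16 * (a.length + r.length) + 40) := by
  have h1 := runs_copyNumber ⟨[], [], [], [], Γ'.ket :: R, []⟩ a r
  have h2 := runs_copyRows ⟨[], [], [], Γ'.comma :: (a.map Γ'.bit).reverse ++ [],
    Γ'.comma :: (a.map Γ'.bit).reverse ++ (Γ'.ket :: R), []⟩ true r
  set R₁ := Γ'.comma :: (a.map Γ'.bit).reverse ++ (Γ'.ket :: R) with hR₁
  set N := Γ'.comma :: (a.map Γ'.bit).reverse ++ [] with hN
  have h3 := runs_move_of_eq (k := Name.count) (k' := .result) (by decide) id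
    (S := Stacks.get ⟨[], [], (commas true r).reverse ++ [], N, (r.flatMap padRow).reverse ++ R₁, []⟩)
    (S' := Stacks.get ⟨[], [], [], N, commas true r ++ ((r.flatMap padRow).reverse ++ R₁), []⟩)
    (by simp) (n := r.length) (by simpa using length_commas_le true r)
  -- The copy of `q` is stored in reverse, as `result` requires; two moves through `temp` keep that
  -- order.
  have h4 := runs_move_of_eq (k := Name.number) (k' := .temp) (by decide) id
    (S := Stacks.get ⟨[], [], [], N, commas true r ++ ((r.flatMap padRow).reverse ++ R₁), []⟩)
    (S' := Stacks.get
      ⟨[], N.reverse, [], [], commas true r ++ ((r.flatMap padRow).reverse ++ R₁), []⟩)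
    (by simp) (n := a.length + 1) (by simp [hN])
  have h5 := runs_move_of_eq (k := Name.temp) (k' := .result) (by decide) id
    (S := Stacks.get ⟨[], N.reverse, [], [], commas true r ++ ((r.flatMap padRow).reverse ++ R₁), []⟩)
    (S' := Stacks.get ⟨[], [], [], [], N ++ (commas true r ++ ((r.flatMap padRow).reverse ++ R₁)), []⟩)
    (by simp) (n := a.length + 1) (by simp [hN])
  have h6 := runs_move_of_eq (k := Name.result) (k' := .output) (by decide) id
    (S := Stacks.get ⟨[], [], [], [],
      Γ'.ket :: (N ++ (commas true r ++ ((r.flatMap padRow).reverse ++ R₁))), []⟩)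
    (S' := Stacks.get ⟨[], [], [], [], [],
      (Γ'.ket :: (N ++ (commas true r ++ ((r.flatMap padRow).reverse ++ R₁)))).reverse⟩)
    (by simp) (n := R.length + 2 * a.length + 3 * r.length + 4) (by
      have := length_commas_le true r
      have := length_flatMap_padRow_le r
      simp [hN, hR₁, -List.length_flatMap]
      omega)
  have e : R.reverse ++ Γ'.ket :: (a.map Γ'.bit ++ [Γ'.comma] ++ (r.flatMap padRow ++
      ((commas true r).reverse ++ (a.map Γ'.bit ++ [Γ'.comma] ++ [Γ'.ket])))) =
      (Γ'.ket :: (N ++ (commas true r ++ ((r.flatMap padRow).reverse ++ R₁)))).reverse := by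
    simp [hN, hR₁]
  rw [e]
  have hp (s : Stacks) : (push (Γ := fun _ : Name => Γ') .result Γ'.ket).Runs s.get ()
      { s with result := Γ'.ket :: s.result }.get 1 := by
    simpa using runs_push (Γ := fun _ : Name => Γ') .result Γ'.ket s.get 0
  exact ((hp ⟨_, _, _, _, _, _⟩).bind (h1.bind (h2.bind (h3.bind (h4.bind (h5.bind
    ((hp ⟨_, _, _, _, _, _⟩).bind h6))))))).mono (by omega)

end Extend

open Extend in
/-- The program that extends an instance, with a machine `M` that extends the graph. -/
noncomputable def extendProg (M : FinTM2) (e₀ : Γ' ≃ M.Γ M.k₀) (e₁ : M.Γ M.k₁ ≃ Γ') :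
    have : Finite (Sum.elim M.Γ (fun _ : Name => Γ') (.inl M.k₁)) := .of_equiv _ e₁.symm
    Code (Sum.elim M.Γ fun _ : Name => Γ') Unit :=
  (Code.lift (Γ' := Sum.elim M.Γ fun _ : Name => Γ') Sum.inr split).bind fun _ =>
  have : Finite (Sum.elim M.Γ (fun _ : Name => Γ') (.inr .temp)) := inferInstanceAs (Finite Γ')
  have : Finite (Sum.elim M.Γ (fun _ : Name => Γ') (.inl M.k₁)) := .of_equiv _ e₁.symm
  (Code.move (.inr .temp) (.inl M.k₀) e₀).bind fun _ =>
  (Code.lift (Γ' := Sum.elim M.Γ fun _ : Name => Γ') Sum.inl (Code.ofTM M)).bind fun _ =>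
  (Code.move (.inl M.k₁) (.inr .result) e₁).bind fun _ =>
  Code.lift (Γ' := Sum.elim M.Γ fun _ : Name => Γ') Sum.inr finish

end StackProgram

-- The code of a graph contains no `ket`, so the first `ket` of the input separates the graph from
-- the rest. The given machine sees only the graph.
open StackProgram Computability Turing Extend in
theorem FairInstance.polyTime_extend {𝒢 : GraphClass} {k : ℕ} (hk : 1 ≤ k)
    {ext : ∀ {n : ℕ}, SimpleGraph (Fin n) → SimpleGraph (Fin (n + 1))}
    (hext : ∀ {n : ℕ} (G : SimpleGraph (Fin n)), 𝒢.Mem G → 𝒢.Mem (ext G))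
    (h : Nonempty (TM2ComputableInPolyTime
      (fun G : {G : FinGraph // 𝒢.Mem G.2} => encodeGraph G.1) encodeGraph
      (fun G => ⟨G.1.1 + 1, ext G.1.2⟩))) :
    Nonempty (TM2ComputableInPolyTime (FairInstance.encode (k := k) (𝒢 := 𝒢)) FairInstance.encode
      fun I => I.extend (ext I.graph) (hext _ I.mem)) := by
  obtain ⟨M, e₀, e₁, p, hM⟩ := Code.exists_of_polyTime h.some
  have : Fintype M.K := M.kFin
  have : Finite (Sum.elim M.Γ (fun _ : Name => Γ') (.inr .input)) := inferInstanceAs (Finite Γ')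
  -- The factor 7: one run of `M`, and two moves of its output at three steps per symbol, the output
  -- having length at most that of the input plus `p`.
  refine Code.polyTime (extendProg M e₀ e₁) (.inr .input) (.inr .output) (Equiv.refl Γ')
    (Equiv.refl Γ') (7 * p + 30 * Polynomial.X + 100) fun I => ?_
  set g := encodeGraph ⟨I.n, I.graph⟩ with hg
  set g' := encodeGraph ⟨I.n + 1, ext I.graph⟩ with hg'
  set r := encodeNumber I.q ++ profitString I.profit with hr
  have hM := hM ⟨⟨I.n, I.graph⟩, I.mem⟩
  change Code.Runs _ (single M.k₀ (g.map e₀)) () (single M.k₁ (g'.map e₁.symm))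
    (p.eval g.length) at hM
  have hlen : g'.length ≤ g.length + p.eval g.length := by
    have := hM.length_le M.k₁
    refine (by simpa [single] using this : _ ≤ _).trans (Nat.add_le_add_right ?_ _)
    by_cases h : M.k₁ = M.k₀
    · rw [h]; simp
    · rw [Function.update_of_ne h]; simp
  have h1 : split.Runs (Stacks.get ⟨g ++ Γ'.ket :: r, [], [], [], [], []⟩) ()
      (Stacks.get ⟨r, g.reverse, [], [], [], []⟩) (3 * g.length + 2) := by
    simpa using runs_split ⟨[], [], [], [], [], []⟩ g r (ket_notMem_encodeGraph _)
  have : Finite (Sum.elim M.Γ (fun _ : Name => Γ') (.inr .temp)) := inferInstanceAs (Finite Γ')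
  have : Finite (Sum.elim M.Γ (fun _ : Name => Γ') (.inl M.k₁)) := .of_equiv _ e₁.symm
  have hs : single M.k₁ (g'.map e₁.symm) M.k₁ = g'.map e₁.symm := Function.update_self ..
  have h2 := Code.runs_move_inr_inl (Γ := M.Γ) (Δ := fun _ : Name => Γ') (S := fun _ => [])
    (T := Stacks.get ⟨r, g.reverse, [], [], [], []⟩) (T' := Stacks.get ⟨r, [], [], [], [], []⟩)
    (l := .temp) (k := M.k₀) (S' := single M.k₀ (g.map e₀)) (n := g.length) e₀
    (by simp [single]) (by simp) (by simp)
  have h3 := hM.lift_inl (Δ := fun _ : Name => Γ') (Stacks.get ⟨r, [], [], [], [], []⟩)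
  have h4 := Code.runs_move_inl_inr (Γ := M.Γ) (Δ := fun _ : Name => Γ')
    (S := single M.k₁ (g'.map e₁.symm)) (S' := fun _ => [])
    (T := Stacks.get ⟨r, [], [], [], [], []⟩) (T' := Stacks.get ⟨r, [], [], [], g'.reverse, []⟩)
    (l := .result) (k := M.k₁) (n := g'.length) e₁ (by simp [hs]) (by simp [single])
    (by rw [hs, List.length_map])
  have h5 := (runs_finish (encodeNat I.q) (profitString I.profit) g'.reverse).lift_inr
    (Γ := M.Γ) fun _ => []
  have er : (encodeNat I.q).map Γ'.bit ++ Γ'.comma :: profitString I.profit = r := by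
    simp [hr, encodeNumber]
  rw [er] at h5
  have e0 : single (Γ := Sum.elim M.Γ fun _ : Name => Γ') (.inr .input)
      (I.encode.map (Equiv.refl Γ')) =
      Code.join (fun _ => []) (Stacks.get ⟨g ++ Γ'.ket :: r, [], [], [], [], []⟩) := by
    refine (Code.single_inr (Γ := M.Γ) (Δ := fun _ : Name => Γ') .input _).trans ?_
    congr 1
    funext j
    cases j <;> simp [single, encode_eq] <;> rfl
  have e1 : single (Γ := Sum.elim M.Γ fun _ : Name => Γ') (.inr .output)
      ((I.extend (ext I.graph) (hext _ I.mem)).encode.map (Equiv.refl Γ').symm) =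
      Code.join (fun _ => []) (Stacks.get ⟨[], [], [], [], [], g'.reverse.reverse ++ Γ'.ket ::
        ((encodeNat I.q).map Γ'.bit ++ [Γ'.comma] ++ ((profitString I.profit).flatMap padRow ++
        ((commas true (profitString I.profit)).reverse ++
        ((encodeNat I.q).map Γ'.bit ++ [Γ'.comma] ++ [Γ'.ket]))))⟩) := by
    refine (Code.single_inr (Γ := M.Γ) (Δ := fun _ : Name => Γ') .output _).trans ?_
    congr 1
    rw [commas_profitString hk, List.reverse_replicate]
    funext j
    cases j <;> simp [single, encode_eq, extend, profitString_extendProfit, encodeNumber] <;> rfl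
  have hrun : (extendProg M e₀ e₁).Runs _ () _ _ :=
    (h1.lift_inr (Γ := M.Γ) fun _ => []).bind (h2.bind (h3.bind (h4.bind h5)))
  refine hrun.of_eq e0 e1 ?_
  have hle : I.encode.length = g.length + 1 + r.length := by
    rw [encode_eq]; simp only [List.length_append, List.length_cons, hr, hg]; omega
  have hrl : r.length = (encodeNat I.q).length + 1 + (profitString I.profit).length := by
    simp only [hr, encodeNumber, List.length_append, List.length_map, List.length_singleton]
  have := eval_mono p (show g.length ≤ I.encode.length by omega)
  simp only [List.length_reverse, Polynomial.eval_add, Polynomial.eval_mul, Polynomial.eval_X,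
    Polynomial.eval_ofNat]
  omega

/-! ### The verifier, as a function -/

namespace Verifier

open Computability (Γ' encodeNat)

/-! ### Binary arithmetic, least significant digit first. -/

/-- The number with the binary digits `l`, the least significant one first. -/
def val : List Bool → ℕ
  | [] => 0
  | b :: l => b.toNat + 2 * val l

theorem val_append (l l' : List Bool) : val (l ++ l') = val l + 2 ^ l.length * val l' := by
  induction l with
  | nil => simp [val]
  | cons b l ih => simp only [List.cons_append, val, ih, List.length_cons, pow_succ]; ring

theorem val_encodeNat (n : ℕ) : val (encodeNat n) = n := by
  have h (m : PosNum) : val (Computability.encodePosNum m) = m := by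
    induction m with
    | one => rfl
    | bit1 m ih => simp [Computability.encodePosNum, val, ih]; ring
    | bit0 m ih => simp [Computability.encodePosNum, val, ih]; ring
  conv_rhs => rw [← Num.to_of_nat n]
  unfold encodeNat
  cases (n : Num) with
  | zero => rfl
  | pos m => simpa [Computability.encodeNum] using h m

/-- Add a carry to a binary number. -/
def inc : Bool → List Bool → List Bool
  | c, [] => [c]
  | c, a :: l => (a ^^ c) :: inc (a && c) l

theorem val_inc (c : Bool) (l : List Bool) : val (inc c l) = val l + c.toNat := by
  induction l generalizing c with
  | nil => cases c <;> rfl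
  | cons a l ih => cases a <;> cases c <;> simp [inc, val, ih] <;> omega

theorem length_inc (c : Bool) (l : List Bool) : (inc c l).length = l.length + 1 := by
  induction l generalizing c with
  | nil => rfl
  | cons a l ih => simp [inc, ih]

/-- Whether the first number is greater than the second one, or equal to it and `c` holds. -/
def ge : Bool → List Bool → List Bool → Bool
  | c, [], [] => c
  | c, a :: l, [] => ge (a || c) l []
  | c, [], b :: l' => ge (!b && c) [] l'
  | c, a :: l, b :: l' => ge (if a = b then c else a) l l'

/-- The digits arrive by increasing weight, so a later difference overrides all earlier ones; `c` is
the verdict on the digits read so far. -/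
theorem ge_eq_true_iff (c : Bool) (l l' : List Bool) :
    ge c l l' = true ↔ val l' < val l ∨ val l' = val l ∧ c = true := by
  induction c, l, l' using ge.induct with
  | case1 c => simp [ge]
  | case2 c a l ih => rw [ge, ih]; cases a <;> cases c <;> simp [val] <;> omega
  | case3 c b l ih => rw [ge, ih]; cases b <;> cases c <;> simp [val]
  | case4 c a l b l' ih =>
    cases a <;> cases b <;> cases c <;> simp_all [ge, val] <;> omega

theorem ge_true (l l' : List Bool) : ge true l l' = decide (val l' ≤ val l) := by
  rw [Bool.eq_iff_iff, ge_eq_true_iff, decide_eq_true_eq]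
  simp only [and_true]
  omega

/-- The majority of three bits. -/
def majority (a b c : Bool) : Bool := a && b || a && c || b && c

/-! ### The verifier as a pass over the instance. -/

/-- The stages of the computation. -/
inductive Phase
  | graph
  | bound
  | profits

instance : Finite Phase :=
  .of_surjective (fun i : Fin 3 => ![Phase.graph, .bound, .profits] i) (by
    rintro (_ | _ | _)
    exacts [⟨0, rfl⟩, ⟨1, rfl⟩, ⟨2, rfl⟩])

/-- The contents of the stacks. -/
structure Stacks (ℓ : ℕ) where
  input : List (Γ' ⊕ Bool) := []
  reversed : List Γ' := []
  text : List Γ' := []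
  colors : List (Option (Fin ℓ)) := []
  visited : List (Option (Fin ℓ)) := []
  current : List (Option (Fin ℓ)) := []
  rows : List (Fin ℓ) := []
  bound : List Bool := []
  boundRev : List Bool := []
  acc : List Bool := []
  accRev : List Bool := []
  output : List Bool := []

/-- The finite control: the stage, whether all tests so far were successful, and the carry. -/
abbrev Control : Type := Phase × Bool × Bool

variable {ℓ : ℕ}

/-- Whether two adjacent vertices have the same color. -/
def conflict (c c' : Option (Option (Fin ℓ))) : Bool :=
  c.join.isSome && decide (c.join = c'.join)

/-- Process one symbol of the instance. -/
def step : Control → Stacks ℓ → Γ' → Control × Stacks ℓ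
  | (.graph, ok, c), s, .bit b =>
    ((.graph, ok && !(b && conflict s.colors.head? s.current.head?), c),
      { s with
        colors := s.colors.tail
        visited := s.colors.head?.join :: s.visited })
  | (.graph, ok, c), s, .comma =>
    ((.graph, ok, c),
      { s with
        colors := s.visited.reverse ++ s.colors
        visited := []
        current := s.current.tail })
  | (.graph, ok, c), s, _ => ((.bound, ok, c), s)
  | (.bound, ok, c), s, .bit b => ((.bound, ok, c), { s with boundRev := b :: s.boundRev })
  | (.bound, ok, _), s, _ =>
    ((.profits, ok, false), { s with bound := s.boundRev.reverse ++ s.bound, boundRev := [] })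
  | (.profits, ok, c), s, .bit b =>
    let x := b && conflict s.colors.head? (s.rows.head?.map some)
    let a := s.acc.head?.getD false
    ((.profits, ok, majority a x c), { s with acc := s.acc.tail, accRev := (a ^^ x ^^ c) :: s.accRev })
  | (.profits, ok, c), s, .comma =>
    ((.profits, ok, false),
      { s with
        acc := s.accRev.reverse ++ inc c s.acc
        accRev := []
        colors := s.colors.tail
        visited := s.colors.head?.join :: s.visited })
  | (.profits, ok, c), s, _ =>
    ((.profits, ok && ge true s.acc s.bound, c),
      { s with
        acc := []
        bound := s.boundRev.reverse ++ s.bound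
        boundRev := []
        colors := s.visited.reverse ++ s.colors
        visited := []
        rows := s.rows.tail })

/-- Process a string. -/
def run (w : Control × Stacks ℓ) (l : List Γ') : Control × Stacks ℓ :=
  l.foldl (fun w g => step w.1 w.2 g) w

@[simp] theorem run_nil (w : Control × Stacks ℓ) : run w [] = w := rfl

theorem run_cons (w : Control × Stacks ℓ) (g : Γ') (l : List Γ') :
    run w (g :: l) = run (step w.1 w.2 g) l := rfl

theorem run_append (w : Control × Stacks ℓ) (l l' : List Γ') :
    run w (l ++ l') = run (run w l) l' := List.foldl_append

theorem run_graph_bits (ps : List (Bool × Option (Fin ℓ))) (ok c : Bool) (s : Stacks ℓ)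
    (rest : List (Option (Fin ℓ))) :
    run ((.graph, ok, c), { s with colors := ps.map Prod.snd ++ rest })
        (ps.map fun p => Γ'.bit p.1) =
      ((.graph, ok && ps.all fun p => !(p.1 && conflict (some p.2) s.current.head?), c),
        { s with colors := rest, visited := (ps.map Prod.snd).reverse ++ s.visited }) := by
  induction ps generalizing ok s with
  | nil => simp
  | cons p ps ih =>
    have := ih (ok && !(p.1 && conflict (some p.2) s.current.head?))
      { s with visited := p.2 :: s.visited }
    simpa [run_cons, step, Bool.and_assoc] using this

/-- During row `i` the top of `current` is the color of `i`, while `colors` scrolls through the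
columns. The comma rewinds `colors` and advances `current`. -/
theorem run_graph {n : ℕ} (adj : Fin n → Fin n → Bool) (col : Fin n → Option (Fin ℓ))
    (l : List (Fin n)) (ok c : Bool) (s : Stacks ℓ) (rest rest' : List (Option (Fin ℓ))) :
    run ((.graph, ok, c), { s with
        colors := (List.finRange n).map col ++ rest
        visited := []
        current := l.map col ++ rest' })
        (l.flatMap fun i => (List.finRange n).map (fun j => Γ'.bit (adj i j)) ++ [Γ'.comma]) =
      ((.graph, ok && l.all fun i => (List.finRange n).all fun j =>
          !(adj i j && conflict (some (col j)) (some (col i))), c),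
        { s with colors := (List.finRange n).map col ++ rest, visited := [], current := rest' }) := by
  induction l generalizing ok with
  | nil => simp
  | cons i l ih =>
    have h := run_graph_bits ((List.finRange n).map fun j => (adj i j, col j)) ok c
      { s with visited := [], current := (i :: l).map col ++ rest' } rest
    simp only [List.map_map, Function.comp_def, List.all_map] at h
    rw [List.flatMap_cons, run_append, run_append, h, run_cons, run_nil]
    simp only [step, List.map_cons, List.cons_append, List.head?_cons, List.tail_cons,
      List.append_nil, List.reverse_reverse]
    rw [ih, List.all_cons, Bool.and_assoc]

theorem run_bound (a : ℕ) (ok c : Bool) (s : Stacks ℓ) :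
    run ((.bound, ok, c), { s with bound := [], boundRev := [] }) (encodeNumber a) =
      ((.profits, ok, false), { s with bound := encodeNat a, boundRev := [] }) := by
  have h (l : List Bool) (s : Stacks ℓ) : run ((.bound, ok, c), s) (l.map Γ'.bit) =
      ((.bound, ok, c), { s with boundRev := l.reverse ++ s.boundRev }) := by
    induction l generalizing s with
    | nil => simp
    | cons b l ih => simp [run_cons, step, ih]
  rw [encodeNumber, run_append, h]
  simp [run_cons, step]

/-- Invariant of bitwise addition: the finished digits, plus the rest of the accumulator and the
carry at their place value, plus what remains of the summand. Only values are tracked, since leading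
zeros may appear. The summand counts only if the vertex has the color of the current row. -/
theorem run_profits_bits (l : List Bool) (ok c : Bool) (s : Stacks ℓ) :
    ∃ c' acc accRev, run ((.profits, ok, c), s) (l.map Γ'.bit) =
      ((.profits, ok, c'), { s with acc := acc, accRev := accRev }) ∧
      val accRev.reverse + 2 ^ accRev.length * (val acc + c'.toNat) =
        val s.accRev.reverse + 2 ^ s.accRev.length * (val s.acc + c.toNat +
          bif conflict s.colors.head? (s.rows.head?.map some) then val l else 0) := by
  induction l generalizing c s with
  | nil => exact ⟨c, s.acc, s.accRev, rfl, by simp [val]⟩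
  | cons b l ih =>
    obtain ⟨c', acc, accRev, h, hv⟩ := ih
      (step (.profits, ok, c) s (.bit b)).1.2.2 (step (.profits, ok, c) s (.bit b)).2
    refine ⟨c', acc, accRev, ?_, ?_⟩
    · rw [List.map_cons, run_cons]
      exact h
    · rw [hv]
      simp only [step]
      cases conflict s.colors.head? (s.rows.head?.map some) <;> rcases s.acc with _ | ⟨a, t⟩
      · cases b <;> cases c <;> simp [val, val_append, majority, pow_succ]
      · cases a <;> cases b <;> cases c <;> simp [val, val_append, majority, pow_succ] <;> ring
      · cases b <;> cases c <;> simp [val, val_append, majority, pow_succ] <;> ring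
      · cases a <;> cases b <;> cases c <;> simp [val, val_append, majority, pow_succ] <;> ring

theorem run_number (a : ℕ) (ok : Bool) (s : Stacks ℓ) (x : Option (Fin ℓ))
    (xs : List (Option (Fin ℓ))) (j : Fin ℓ) (js : List (Fin ℓ)) (acc : List Bool) :
    ∃ acc', run ((.profits, ok, false), { s with
        acc := acc, accRev := [], colors := x :: xs, rows := j :: js }) (encodeNumber a) =
      ((.profits, ok, false), { s with
        acc := acc', accRev := [], colors := xs, rows := j :: js, visited := x :: s.visited }) ∧
      val acc' = val acc + if x = some j then a else 0 := by
  obtain ⟨c', acc', accRev, h, hv⟩ := run_profits_bits (encodeNat a) ok false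
    { s with acc := acc, accRev := [], colors := x :: xs, rows := j :: js }
  refine ⟨accRev.reverse ++ inc c' acc', ?_, ?_⟩
  · rw [encodeNumber, run_append, h, run_cons, run_nil]
    rfl
  · rw [val_append, val_inc, List.length_reverse, hv]
    have : conflict (some x) (some (some j)) = decide (x = some j) := by
      cases x <;> simp [conflict]
    simp [val, val_encodeNat, this]

theorem run_row {n : ℕ} (p : Fin n → ℕ) (col : Fin n → Option (Fin ℓ)) (l : List (Fin n))
    (ok : Bool) (s : Stacks ℓ) (rest : List (Option (Fin ℓ))) (j : Fin ℓ) (js : List (Fin ℓ))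
    (acc : List Bool) :
    ∃ acc', run ((.profits, ok, false), { s with
        acc := acc, accRev := [], colors := l.map col ++ rest, rows := j :: js })
        (l.flatMap fun v => encodeNumber (p v)) =
      ((.profits, ok, false), { s with
        acc := acc', accRev := [], colors := rest, rows := j :: js,
        visited := (l.map col).reverse ++ s.visited }) ∧
      val acc' = val acc + (l.map fun v => if col v = some j then p v else 0).sum := by
  induction l generalizing s acc with
  | nil => exact ⟨acc, by simp, by simp⟩
  | cons v l ih =>
    obtain ⟨acc₁, h₁, hv₁⟩ := run_number (p v) ok s (col v) (l.map col ++ rest) j js acc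
    obtain ⟨acc₂, h₂, hv₂⟩ := ih { s with visited := col v :: s.visited } acc₁
    refine ⟨acc₂, ?_, ?_⟩
    · rw [List.flatMap_cons, run_append, List.map_cons, List.cons_append, h₁, h₂]
      simp
    · rw [hv₂, hv₁, List.map_cons, List.sum_cons, add_assoc]

/-- After each row the comparison restores the bound, the colors are rewound and the accumulator is
emptied, so all rows start alike. -/
theorem run_profits {n : ℕ} (p : Fin ℓ → Fin n → ℕ) (col : Fin n → Option (Fin ℓ))
    (l : List (Fin ℓ)) (ok : Bool) (s : Stacks ℓ) (rest : List (Option (Fin ℓ))) :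
    run ((.profits, ok, false), { s with
        acc := [], accRev := [], colors := (List.finRange n).map col ++ rest, visited := [],
        boundRev := [], rows := l })
        (l.flatMap fun j =>
          (List.finRange n).flatMap (fun v => encodeNumber (p j v)) ++ [Γ'.ket]) =
      ((.profits, ok && l.all fun j => decide (val s.bound ≤
          ((List.finRange n).map fun v => if col v = some j then p j v else 0).sum), false),
        { s with
        acc := [], accRev := [], colors := (List.finRange n).map col ++ rest, visited := [],
        boundRev := [], rows := [] }) := by
  induction l generalizing ok with
  | nil => simp
  | cons j l ih =>
    obtain ⟨acc, h, hv⟩ := run_row (p j) col (List.finRange n) ok { s with visited := [], boundRev := [] }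
      rest j l []
    rw [List.flatMap_cons, run_append, run_append, h, run_cons, run_nil]
    simp only [step, List.tail_cons, List.append_nil, List.reverse_reverse, List.reverse_nil,
      List.nil_append]
    rw [ih, List.all_cons, Bool.and_assoc, ge_true, hv]
    simp [val]

/-- The result of the verifier on an instance, for a given list of colors. -/
theorem run_encode {𝒢 : GraphClass} (I : FairInstance ℓ 𝒢) (col : Fin I.n → Option (Fin ℓ))
    (rest : List (Option (Fin ℓ))) :
    (run ((.graph, true, false), ({
        colors := (List.finRange I.n).map col ++ rest
        current := (List.finRange I.n).map col ++ rest
        rows := List.finRange ℓ } : Stacks ℓ)) I.encode).1.2.1 = true ↔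
      (∀ u v, I.graph.Adj u v → col u = col v → col u = none) ∧
      ∀ j, I.q ≤ ∑ v, if col v = some j then I.profit j v else 0 := by
  classical
  have e : I.encode = ((List.finRange I.n).flatMap fun i =>
      (List.finRange I.n).map (fun j => Γ'.bit (decide (I.graph.Adj i j))) ++ [Γ'.comma]) ++
      Γ'.ket :: (encodeNumber I.q ++ (List.finRange ℓ).flatMap fun j =>
        (List.finRange I.n).flatMap (fun v => encodeNumber (I.profit j v)) ++ [Γ'.ket]) := by
    unfold FairInstance.encode encodeGraph
    congr!
  rw [e, run_append, run_graph (fun i j => decide (I.graph.Adj i j)) col (List.finRange I.n) true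
    false { rows := List.finRange ℓ } rest rest, run_cons]
  simp only [step]
  rw [run_append, run_bound I.q _ false { current := rest, rows := List.finRange ℓ, colors := _ },
    run_profits I.profit col (List.finRange ℓ) _ { current := rest, bound := encodeNat I.q }]
  simp only [val_encodeNat, conflict, Fin.sum_univ_def]
  simp
  grind

/-- Disjointness of the classes says that a vertex has at most one color, so a partial coloring is a
function with values in `Option (Fin ℓ)`. -/
theorem exists_coloring_iff {n : ℕ} (G : SimpleGraph (Fin n)) (p : Fin ℓ → Fin n → ℕ) (q : ℕ) :
    (∃ c : PartialColoring G ℓ, ∀ j, q ≤ ∑ v ∈ c.X j, p j v) ↔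
      ∃ col : Fin n → Option (Fin ℓ), (∀ u v, G.Adj u v → col u = col v → col u = none) ∧
        ∀ j, q ≤ ∑ v, if col v = some j then p j v else 0 := by
  classical
  constructor
  · rintro ⟨c, hc⟩
    let col (v : Fin n) : Option (Fin ℓ) := if h : ∃ j, v ∈ c.X j then some h.choose else none
    have hcol (v j) : col v = some j ↔ v ∈ c.X j := by
      unfold col
      split_ifs with h
      · rw [Option.some_inj]
        refine ⟨fun e => e ▸ h.choose_spec, fun hv => ?_⟩
        by_contra hne
        exact Finset.disjoint_left.1 (c.disjoint hne) h.choose_spec hv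
      · simpa using fun hv => h ⟨j, hv⟩
    refine ⟨col, fun u v huv e => ?_, fun j => ?_⟩
    · cases hu : col u with
      | none => rfl
      | some j =>
        exact absurd huv (c.indep j ((hcol u j).1 hu) ((hcol v j).1 (e ▸ hu)) huv.ne)
    · simpa [hcol, Finset.sum_ite_mem] using hc j
  · rintro ⟨col, hadj, hsum⟩
    refine ⟨⟨fun j => Finset.univ.filter fun v => col v = some j, ?_, ?_⟩, fun j => ?_⟩
    · intro i j hij
      rw [Finset.disjoint_left]
      intro v hi hj
      simp only [Finset.mem_filter_univ] at hi hj
      exact hij (Option.some_inj.1 (hi.symm.trans hj))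
    · intro j u hu v hv _ huv
      simp only [Finset.coe_filter_univ, Set.mem_ofPred_eq] at hu hv
      simp [hadj u v huv (hu.trans hv.symm)] at hu
    · rw [Finset.sum_filter]
      exact hsum j

/-! ### Certificates. -/

/-- The next value of the counter that reads the code of a color. -/
def next (c : Fin (ℓ + 1)) : Fin (ℓ + 1) := if h : c.1 < ℓ then ⟨c.1 + 1, by omega⟩ else c

/-- The color for a value of the counter. -/
def toColor (c : Fin (ℓ + 1)) : Option (Fin ℓ) := if h : c.1 < ℓ then some ⟨c.1, h⟩ else none

/-- The list of colors given by a certificate: each color is written in unary and ends with `true`.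
The colors are pushed on `L`. -/
def parse : List Bool → Fin (ℓ + 1) → List (Option (Fin ℓ)) → List (Option (Fin ℓ))
  | [], _, L => L
  | false :: y, c, L => parse y (next c) L
  | true :: y, c, L => parse y 0 (toColor c :: L)

theorem length_le_parse (y : List Bool) (c : Fin (ℓ + 1)) (L : List (Option (Fin ℓ))) :
    L.length ≤ (parse y c L).length := by
  induction y generalizing c L with
  | nil => rfl
  | cons b y ih =>
    cases b
    · exact ih ..
    · exact (Nat.le_succ _).trans (ih 0 (toColor c :: L))

theorem parse_length_le (y : List Bool) (c : Fin (ℓ + 1)) (L : List (Option (Fin ℓ))) :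
    (parse y c L).length ≤ L.length + y.length := by
  induction y generalizing c L with
  | nil => rfl
  | cons b y ih =>
    cases b
    · exact (ih ..).trans (by simp)
    · exact (ih ..).trans (by simp; omega)

theorem parse_replicate (i : ℕ) (w : List Bool) (c : Fin (ℓ + 1)) (h : c.1 + i < ℓ + 1)
    (L : List (Option (Fin ℓ))) :
    parse (List.replicate i false ++ w) c L = parse w ⟨c.1 + i, h⟩ L := by
  induction i generalizing c with
  | zero => rfl
  | succ i ih =>
    have hn : next c = ⟨c.1 + 1, by omega⟩ := dif_pos (by omega)
    rw [List.replicate_succ, List.cons_append, parse, hn, ih _ (by simp; omega)]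
    congr 2
    simp only
    omega

/-- The code is `i` times `false`, then `true`. The value `i = ℓ`, the largest of the counter, means
uncolored, whence the length bound `ℓ + 1`. -/
theorem exists_parse_color (x : Option (Fin ℓ)) : ∃ y : List Bool, y.length ≤ ℓ + 1 ∧
    ∀ w L, parse (y ++ w) 0 L = parse w 0 (x :: L) := by
  have h (i : ℕ) (hi : i < ℓ + 1) (w L) : parse (List.replicate i false ++ [true] ++ w) 0 L =
      parse w 0 (toColor ⟨i, hi⟩ :: L) := by
    rw [List.append_assoc, parse_replicate i _ 0 (by simpa using hi)]
    simp [parse]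
  cases x with
  | none => exact ⟨_, by simp, fun w L => (h ℓ (by omega) w L).trans (by simp [toColor])⟩
  | some j =>
    refine ⟨_, ?_, fun w L => (h j (by omega) w L).trans (by simp [toColor])⟩
    simp

theorem exists_parse (l : List (Option (Fin ℓ))) : ∃ y : List Bool,
    y.length ≤ (ℓ + 1) * l.length ∧ ∀ w L, parse (y ++ w) 0 L = parse w 0 (l ++ L) := by
  induction l with
  | nil => exact ⟨[], by simp, fun _ _ => rfl⟩
  | cons x l ih =>
    obtain ⟨y, hy, h⟩ := ih
    obtain ⟨y', hy', h'⟩ := exists_parse_color x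
    -- The parser pushes, so the head of the list must be written last.
    refine ⟨y ++ y', ?_, fun w L => ?_⟩
    · rw [List.length_append, List.length_cons, mul_add, mul_one]; omega
    · rw [List.append_assoc, h, h', List.cons_append]

/-- The start of the computation, for a list of colors. -/
def start (L : List (Option (Fin ℓ))) : Control × Stacks ℓ :=
  ((.graph, true, false), { colors := L, current := L, rows := List.finRange ℓ })

/-- The verifier. -/
noncomputable def verify {𝒢 : GraphClass} (I : FairInstance ℓ 𝒢) (y : List Bool) : Bool :=
  -- Padding by uncolored entries guarantees at least `n` colors for any certificate. The input
  -- length bounds `n` and is available to the program without decoding.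
  (run (start (ℓ := ℓ) (parse y 0 (List.replicate I.encode.length none))) I.encode).1.2.1

theorem n_le_length_encode {𝒢 : GraphClass} (I : FairInstance ℓ 𝒢) : I.n ≤ I.encode.length := by
  have hg (G : FinGraph) : (encodeGraph G).length = G.1 * (G.1 + 1) := by
    simp [encodeGraph, List.length_flatMap]
  rw [FairInstance.encode_eq, List.length_append, hg]
  nlinarith

theorem yes_iff_exists_verify {𝒢 : GraphClass} (hℓ : 1 ≤ ℓ) (I : FairInstance ℓ 𝒢) :
    (fairDivision ℓ 𝒢).Yes I ↔
      ∃ y : List Bool, y.length ≤ (ℓ + 1) * I.encode.length ∧ verify I y = true := by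
  have h : (fairDivision ℓ 𝒢).Yes I ↔
      ∃ c : PartialColoring I.graph ℓ, ∀ j, I.q ≤ ∑ v ∈ c.X j, I.profit j v :=
    exists_congr fun c => FairInstance.le_satisfactionLevel _ _ hℓ c
  rw [h, exists_coloring_iff]
  constructor
  · rintro ⟨col, hcol⟩
    obtain ⟨y, hy, hp⟩ := exists_parse ((List.finRange I.n).map col)
    refine ⟨y, ?_, ?_⟩
    · refine hy.trans (Nat.mul_le_mul_left _ ?_)
      simpa using n_le_length_encode I
    · have := hp [] (List.replicate I.encode.length none)
      rw [List.append_nil] at this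
      rw [verify, this]
      exact (run_encode I col _).2 hcol
  · rintro ⟨y, -, hy⟩
    rw [verify] at hy
    set L := parse (ℓ := ℓ) y 0 (List.replicate I.encode.length none) with hL
    have hlen : I.n ≤ L.length := by
      refine (n_le_length_encode I).trans (le_trans ?_ (length_le_parse ..))
      simp
    -- The first `n` entries give the coloring; `run_encode` allows an arbitrary surplus below them.
    have e : L = (List.finRange I.n).map (fun v => L[v.1]) ++ L.drop I.n := by
      conv_lhs => rw [← List.take_append_drop I.n L]
      congr 1
      refine List.ext_getElem (by simp [hlen]) fun i h1 h2 => ?_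
      simp
    rw [e] at hy
    exact ⟨_, (run_encode I _ _).1 hy⟩

end Verifier

/-! ### The verifier, as a program -/

namespace StackProgram.Code

open Function (update update_eq_self update_idem update_self update_of_ne)

variable {K : Type} [DecidableEq K] {Γ : K → Type}

/-- Empty the stack `k`. -/
def clear (k : K) : Code Γ Unit :=
  loop (σ := Unit) (fun _ => pop k fun o => if o.isSome then .inl () else .inr ()) ()

theorem runs_clear (k : K) (S : ∀ k, List (Γ k)) :
    (clear k).Runs S () (update S k []) (2 * (S k).length + 2) := by
  generalize h : S k = l
  induction l generalizing S with
  | nil =>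
    refine Runs.loop_exit (t := 1) ?_
    have := runs_pop k (fun o => if o.isSome then .inl () else .inr () : _ → Unit ⊕ Unit) S 0
    rwa [h] at this
  | cons a l ih =>
    have := runs_pop k (fun o => if o.isSome then .inl () else .inr () : _ → Unit ⊕ Unit) S 0
    rw [h] at this
    have h' := ih (update S k l) (update_self ..)
    rw [update_idem] at h'
    exact (Runs.loop_continue (s' := ()) this h').mono (by simp only [List.length_cons]; omega)

/-- Empty the given stacks. -/
def clearAll : List K → Code Γ Unit
  | [] => pure ()
  | k :: l => (clear k).bind fun _ => clearAll l

theorem runs_clearAll (l : List K) (S : ∀ k, List (Γ k)) (n : ℕ) (hn : ∀ k, (S k).length ≤ n) :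
    (clearAll l).Runs S () (fun k => if k ∈ l then [] else S k) (l.length * (2 * n + 2)) := by
  induction l generalizing S with
  | nil => exact (runs_pure () S _).of_eq rfl (by simp) le_rfl
  | cons k l ih =>
    have h := (runs_clear k S).mono (Nat.add_le_add_right (Nat.mul_le_mul_left 2 (hn k)) 2)
    have h' := ih (update S k []) fun j => by
      rcases eq_or_ne j k with rfl | hj
      · simp
      · rw [update_of_ne hj]; exact hn j
    refine (h.bind h').of_eq rfl ?_ (by rw [List.length_cons]; linarith)
    funext j
    rcases eq_or_ne j k with rfl | hj <;> simp [*]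

/-- Push the symbols of a list. -/
def pushAll (k : K) : List (Γ k) → Code Γ Unit
  | [] => pure ()
  | a :: l => (pushAll k l).bind fun _ => push k a

theorem runs_pushAll (k : K) (l : List (Γ k)) (S : ∀ k, List (Γ k)) :
    (pushAll k l).Runs S () (update S k (l ++ S k)) l.length := by
  induction l with
  | nil => exact (runs_pure () S _).of_eq rfl (by simp) le_rfl
  | cons a l ih => exact (ih.bind (runs_push k a _ 0)).of_eq rfl (by simp) le_rfl

end StackProgram.Code

namespace Verifier

open Function (update)
open Computability (Γ')
open StackProgram StackProgram.Code

/-- The names of the stacks. -/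
inductive Name
  | input
  | reversed
  | text
  | colors
  | visited
  | current
  | rows
  | bound
  | boundRev
  | acc
  | accRev
  | output
  deriving DecidableEq

instance : Fintype Name :=
  ⟨{.input, .reversed, .text, .colors, .visited, .current, .rows, .bound, .boundRev, .acc, .accRev,
    .output}, fun k => by cases k <;> decide⟩

/-- The alphabets of the stacks. -/
abbrev Symbol (ℓ : ℕ) : Name → Type
  | .input => Γ' ⊕ Bool
  | .reversed | .text => Γ'
  | .colors | .visited | .current => Option (Fin ℓ)
  | .rows => Fin ℓ
  | .bound | .boundRev | .acc | .accRev | .output => Bool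

variable {ℓ : ℕ}

namespace Stacks

/-- The contents of a stack. -/
def get (s : Stacks ℓ) : ∀ k, List (Symbol ℓ k)
  | .input => s.input
  | .reversed => s.reversed
  | .text => s.text
  | .colors => s.colors
  | .visited => s.visited
  | .current => s.current
  | .rows => s.rows
  | .bound => s.bound
  | .boundRev => s.boundRev
  | .acc => s.acc
  | .accRev => s.accRev
  | .output => s.output

variable (s : Stacks ℓ)

@[simp] theorem update_input (l) : update s.get .input l = { s with input := l }.get := by
  funext j; cases j <;> rfl
@[simp] theorem update_reversed (l) : update s.get .reversed l = { s with reversed := l }.get := by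
  funext j; cases j <;> rfl
@[simp] theorem update_text (l) : update s.get .text l = { s with text := l }.get := by
  funext j; cases j <;> rfl
@[simp] theorem update_colors (l) : update s.get .colors l = { s with colors := l }.get := by
  funext j; cases j <;> rfl
@[simp] theorem update_visited (l) : update s.get .visited l = { s with visited := l }.get := by
  funext j; cases j <;> rfl
@[simp] theorem update_current (l) : update s.get .current l = { s with current := l }.get := by
  funext j; cases j <;> rfl
@[simp] theorem update_rows (l) : update s.get .rows l = { s with rows := l }.get := by
  funext j; cases j <;> rfl
@[simp] theorem update_bound (l) : update s.get .bound l = { s with bound := l }.get := by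
  funext j; cases j <;> rfl
@[simp] theorem update_boundRev (l) : update s.get .boundRev l = { s with boundRev := l }.get := by
  funext j; cases j <;> rfl
@[simp] theorem update_acc (l) : update s.get .acc l = { s with acc := l }.get := by
  funext j; cases j <;> rfl
@[simp] theorem update_accRev (l) : update s.get .accRev l = { s with accRev := l }.get := by
  funext j; cases j <;> rfl

/-- The total length of the stacks that are moved around. -/
def size (s : Stacks ℓ) : ℕ :=
  s.colors.length + s.visited.length + s.bound.length + s.boundRev.length + s.acc.length +
    s.accRev.length

end Stacks

/-- Programs on these stacks. -/
abbrev Prog (ℓ : ℕ) (β : Type) : Type 1 := Code (Symbol ℓ) β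

/-- Read the input: copy the instance, and form the list of colors. -/
def read (c : Fin (ℓ + 1)) : Prog ℓ Unit :=
  loop (σ := Fin (ℓ + 1)) (fun c => (pop .input id).bind fun (o : Option (Γ' ⊕ Bool)) =>
    match o with
    | none => pure (.inr ())
    | some (.inl g) => (push .reversed g).bind fun _ => (push .colors none).bind fun _ =>
        (push .current none).bind fun _ => pure (.inl c)
    | some (.inr false) => pure (.inl (next c))
    | some (.inr true) => (push .colors (toColor c)).bind fun _ =>
        (push .current (toColor c)).bind fun _ => pure (.inl 0)) c

theorem runs_read_certificate (s : Stacks ℓ) (c : Fin (ℓ + 1)) (y : List Bool) :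
    (read c).Runs { s with input := y.map Sum.inr }.get ()
      { s with
        input := []
        colors := parse y c s.colors
        current := parse y c s.current }.get (4 * y.length + 2) := by
  induction y generalizing s c with
  | nil =>
    refine Runs.loop_exit (t := 1) (.pop_bind ?_)
    rw [Stacks.update_input]
    exact runs_pure ..
  | cons b y ih =>
    cases b
    · refine (Runs.loop_continue (t := 1) (.pop_bind ?_) (ih s (next c))).mono ?_
      · rw [Stacks.update_input]
        exact runs_pure ..
      · simp only [List.length_cons]; omega
    · refine (Runs.loop_continue (t := 3) (.pop_bind (.push_bind (.push_bind ?_)))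
        (ih { s with colors := toColor c :: s.colors, current := toColor c :: s.current } 0)).mono ?_
      · rw [Stacks.update_input, Stacks.update_colors, Stacks.update_current]
        exact runs_pure ..
      · simp only [List.length_cons]; omega

/-- Each symbol of the instance leaves one uncolored entry on `colors` and on `current`. This
creates the padding before the certificate is parsed. -/
theorem runs_read (s : Stacks ℓ) (c : Fin (ℓ + 1)) (x : List Γ') (y : List Bool) :
    (read c).Runs { s with input := x.map Sum.inl ++ y.map Sum.inr }.get ()
      { s with
        input := []
        reversed := x.reverse ++ s.reversed
        colors := parse y c (List.replicate x.length none ++ s.colors)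
        current := parse y c (List.replicate x.length none ++ s.current) }.get
      (5 * x.length + 4 * y.length + 2) := by
  induction x generalizing s with
  | nil => exact (runs_read_certificate s c y).mono (by simp)
  | cons g x ih =>
    have := ih { s with
      reversed := g :: s.reversed, colors := none :: s.colors, current := none :: s.current }
    simp only [List.reverse_cons, List.length_cons, List.replicate_succ', List.append_assoc,
      List.singleton_append]
    refine (Runs.loop_continue (t := 4) (.pop_bind (.push_bind (.push_bind (.push_bind ?_))))
      this).mono (by omega)
    rw [Stacks.update_input, Stacks.update_reversed, Stacks.update_colors, Stacks.update_current]
    exact runs_pure ..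

/-- Add the carry to the counter. -/
def flush (c : Bool) : Prog ℓ Unit :=
  loop (σ := Bool) (fun c => (pop .acc id).bind fun (o : Option Bool) =>
    match o with
    | none => (push .accRev c).bind fun _ => pure (.inr ())
    | some a => (push .accRev (a ^^ c)).bind fun _ => pure (.inl (a && c))) c

theorem runs_flush (s : Stacks ℓ) (c : Bool) (l : List Bool) :
    (flush c).Runs { s with acc := l }.get ()
      { s with acc := [], accRev := (inc c l).reverse ++ s.accRev }.get (3 * l.length + 3) := by
  induction l generalizing s c with
  | nil =>
    refine Runs.loop_exit (t := 2) (.pop_bind (.push_bind ?_))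
    rw [Stacks.update_acc, Stacks.update_accRev]
    exact runs_pure ..
  | cons a l ih =>
    have := ih { s with accRev := (a ^^ c) :: s.accRev } (a && c)
    simp only [inc, List.reverse_cons, List.append_assoc, List.singleton_append, List.length_cons]
    refine (Runs.loop_continue (t := 2) (.pop_bind (.push_bind ?_)) this).mono (by omega)
    rw [Stacks.update_acc, Stacks.update_accRev]
    exact runs_pure ..

/-- Compare the counter with the bound. -/
def compare (c : Bool) : Prog ℓ Bool :=
  loop (σ := Bool) (fun c => (pop .acc id).bind fun (a : Option Bool) =>
    (pop .bound id).bind fun (b : Option Bool) =>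
    match a, b with
    | none, none => pure (.inr c)
    | some a, none => pure (.inl (a || c))
    | none, some b => (push .boundRev b).bind fun _ => pure (.inl (!b && c))
    | some a, some b => (push .boundRev b).bind fun _ => pure (.inl (if a = b then c else a))) c

theorem runs_compare (s : Stacks ℓ) (c : Bool) (l l' : List Bool) :
    (compare c).Runs { s with acc := l, bound := l' }.get (ge c l l')
      { s with acc := [], bound := [], boundRev := l'.reverse ++ s.boundRev }.get
      (4 * (l.length + l'.length) + 3) := by
  induction c, l, l' using ge.induct generalizing s with
  | case1 c =>
    refine Runs.loop_exit (t := 2) (.pop_bind (.pop_bind ?_))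
    rw [Stacks.update_acc, Stacks.update_bound, ge]
    exact runs_pure ..
  | case2 c a l ih =>
    rw [ge]
    refine (Runs.loop_continue (t := 2) (.pop_bind (.pop_bind ?_)) (ih s)).mono
      (by simp only [List.length_cons]; omega)
    rw [Stacks.update_acc, Stacks.update_bound]
    exact runs_pure ..
  | case3 c b l' ih =>
    have := ih { s with boundRev := b :: s.boundRev }
    simp only [ge, List.reverse_cons, List.append_assoc, List.singleton_append]
    refine (Runs.loop_continue (t := 3) (.pop_bind (.pop_bind (.push_bind ?_))) this).mono
      (by simp only [List.length_cons]; omega)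
    rw [Stacks.update_acc, Stacks.update_bound, Stacks.update_boundRev]
    exact runs_pure ..
  | case4 c a l b l' ih =>
    have := ih { s with boundRev := b :: s.boundRev }
    simp only [ge, List.reverse_cons, List.append_assoc, List.singleton_append]
    refine (Runs.loop_continue (t := 3) (.pop_bind (.pop_bind (.push_bind ?_))) this).mono
      (by simp only [List.length_cons]; omega)
    rw [Stacks.update_acc, Stacks.update_bound, Stacks.update_boundRev]
    exact runs_pure ..

/-- Process one symbol of the instance. -/
def stepProg : Control → Γ' → Prog ℓ Control
  | (.graph, ok, c), .bit b =>
    (peek .current id).bind fun (o' : Option (Option (Fin ℓ))) =>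
    (pop .colors id).bind fun (o : Option (Option (Fin ℓ))) =>
    (push .visited o.join).bind fun _ => pure (.graph, ok && !(b && conflict o o'), c)
  | (.graph, ok, c), .comma =>
    (move .visited .colors id).bind fun _ => (pop .current fun _ => ()).bind fun _ =>
    pure (.graph, ok, c)
  | (.graph, ok, c), _ => pure (.bound, ok, c)
  | (.bound, ok, c), .bit b => (push .boundRev b).bind fun _ => pure (.bound, ok, c)
  | (.bound, ok, _), _ => (move .boundRev .bound id).bind fun _ => pure (.profits, ok, false)
  | (.profits, ok, c), .bit b =>
    (peek .rows id).bind fun (o' : Option (Fin ℓ)) =>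
    (peek .colors id).bind fun (o : Option (Option (Fin ℓ))) =>
    (pop .acc id).bind fun (a : Option Bool) =>
    (push .accRev (a.getD false ^^ (b && conflict o (o'.map some)) ^^ c)).bind fun _ =>
    pure (.profits, ok, majority (a.getD false) (b && conflict o (o'.map some)) c)
  | (.profits, ok, c), .comma =>
    (flush c).bind fun _ => (move .accRev .acc id).bind fun _ =>
    (pop .colors id).bind fun (o : Option (Option (Fin ℓ))) =>
    (push .visited o.join).bind fun _ => pure (.profits, ok, false)
  | (.profits, ok, c), _ =>
    (compare true).bind fun r => (move .boundRev .bound id).bind fun _ =>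
    (move .visited .colors id).bind fun _ => (pop .rows fun _ => ()).bind fun _ =>
    pure (.profits, ok && r, c)

theorem runs_move_visited (s : Stacks ℓ) :
    (move (Γ := Symbol ℓ) .visited .colors id).Runs s.get ()
      { s with visited := [], colors := s.visited.reverse ++ s.colors }.get
      (3 * s.visited.length + 2) :=
  runs_move_of_eq (S := s.get) (k := .visited) (k' := .colors) (by decide) id
    (by rw [Stacks.update_visited, Stacks.update_colors, List.map_id]; rfl) le_rfl

theorem runs_move_boundRev (s : Stacks ℓ) :
    (move (Γ := Symbol ℓ) .boundRev .bound id).Runs s.get ()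
      { s with boundRev := [], bound := s.boundRev.reverse ++ s.bound }.get
      (3 * s.boundRev.length + 2) :=
  runs_move_of_eq (S := s.get) (k := .boundRev) (k' := .bound) (by decide) id
    (by rw [Stacks.update_boundRev, Stacks.update_bound, List.map_id]; rfl) le_rfl

theorem runs_move_accRev (s : Stacks ℓ) :
    (move (Γ := Symbol ℓ) .accRev .acc id).Runs s.get ()
      { s with accRev := [], acc := s.accRev.reverse ++ s.acc }.get
      (3 * s.accRev.length + 2) :=
  runs_move_of_eq (S := s.get) (k := .accRev) (k' := .acc) (by decide) id
    (by rw [Stacks.update_accRev, Stacks.update_acc, List.map_id]; rfl) le_rfl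

theorem runs_move_reversed (s : Stacks ℓ) :
    (move (Γ := Symbol ℓ) .reversed .text id).Runs s.get ()
      { s with reversed := [], text := s.reversed.reverse ++ s.text }.get
      (3 * s.reversed.length + 2) :=
  runs_move_of_eq (S := s.get) (k := .reversed) (k' := .text) (by decide) id
    (by rw [Stacks.update_reversed, Stacks.update_text, List.map_id]; rfl) le_rfl

theorem runs_pop_rows (s : Stacks ℓ) :
    (pop (Γ := Symbol ℓ) .rows fun _ => ()).Runs s.get () { s with rows := s.rows.tail }.get 1 :=
  (runs_pop ..).of_eq rfl (by rw [Stacks.update_rows]; rfl) le_rfl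

theorem runs_pop_current (s : Stacks ℓ) :
    (pop (Γ := Symbol ℓ) .current fun _ => ()).Runs s.get ()
      { s with current := s.current.tail }.get 1 :=
  (runs_pop ..).of_eq rfl (by rw [Stacks.update_current]; rfl) le_rfl

/-- Handling one symbol traverses each affected stack a bounded number of times, so the cost is
linear in their total length. -/
theorem runs_stepProg (w : Control) (g : Γ') (s : Stacks ℓ) :
    (stepProg w g).Runs s.get (step w s g).1 (step w s g).2.get (10 * s.size + 10) := by
  -- The default branches treat several symbols alike; `ket` is their representative.
  have hgraph (ok c) : (stepProg (.graph, ok, c) .ket).Runs s.get (.bound, ok, c) s.get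
      (10 * s.size + 10) := runs_pure ..
  have hbound (ok c) : (stepProg (.bound, ok, c) .ket).Runs s.get (.profits, ok, false)
      { s with bound := s.boundRev.reverse ++ s.bound, boundRev := [] }.get (10 * s.size + 10) :=
    (runs_move_boundRev s).bind_pure.mono (by unfold Stacks.size; omega)
  have hprofits (ok c) : (stepProg (.profits, ok, c) .ket).Runs s.get
      (step (.profits, ok, c) s .ket).1 (step (.profits, ok, c) s .ket).2.get
      (10 * s.size + 10) := by
    have h1 := runs_compare s true s.acc s.bound
    have h2 := runs_move_boundRev
      { s with acc := [], bound := [], boundRev := s.bound.reverse ++ s.boundRev }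
    have h3 := runs_move_visited
      { s with acc := [], boundRev := [], bound := s.boundRev.reverse ++ s.bound }
    have h4 := runs_pop_rows { s with
      acc := [], boundRev := [], bound := s.boundRev.reverse ++ s.bound
      visited := [], colors := s.visited.reverse ++ s.colors }
    simp only [List.reverse_append, List.reverse_reverse, List.append_nil] at h2
    refine (h1.bind (h2.bind (h3.bind h4.bind_pure))).mono ?_
    simp only [Stacks.size, List.length_append, List.length_reverse]
    omega
  rcases w with ⟨_ | _ | _, ok, c⟩
  · cases g
    case bit b =>
      refine Runs.mono (t := 3) (.peek_bind (.pop_bind (.push_bind ?_))) (by omega)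
      rw [Stacks.update_colors, Stacks.update_visited]
      exact runs_pure ..
    case comma =>
      refine ((runs_move_visited s).bind (runs_pop_current _).bind_pure).mono ?_
      unfold Stacks.size
      omega
    all_goals exact hgraph ok c
  · cases g
    case bit b =>
      refine Runs.mono (t := 1) (.push_bind ?_) (by omega)
      rw [Stacks.update_boundRev]
      exact runs_pure ..
    all_goals exact hbound ok c
  · cases g
    case bit b =>
      refine Runs.mono (t := 4) (.peek_bind (.peek_bind (.pop_bind (.push_bind ?_)))) (by omega)
      rw [Stacks.update_acc, Stacks.update_accRev]
      exact runs_pure ..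
    case comma =>
      have h1 := runs_flush s c s.acc
      have h2 := runs_move_accRev { s with acc := [], accRev := (inc c s.acc).reverse ++ s.accRev }
      simp only [List.reverse_append, List.reverse_reverse, List.append_nil] at h2
      refine (h1.bind (h2.bind (t' := 2) (.pop_bind (.push_bind ?_)))).mono ?_
      · rw [Stacks.update_colors, Stacks.update_visited]
        exact runs_pure ..
      · simp only [Stacks.size, List.length_append, List.length_reverse, length_inc]
        omega
    all_goals exact hprofits ok c

/-- The worst case is a comma among the profits: the carry lengthens the accumulator by one, and a
default color may be pushed when `colors` is empty. Linear growth keeps the whole pass quadratic. -/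
theorem size_step_le (w : Control) (g : Γ') (s : Stacks ℓ) :
    (step w s g).2.size ≤ s.size + 2 := by
  rcases w with ⟨_ | _ | _, ok, c⟩ <;> cases g <;>
    simp only [step, Stacks.size, List.length_append, List.length_reverse, List.length_cons,
      List.length_tail, List.length_nil, length_inc] <;> omega

theorem step_text (w : Control) (g : Γ') (s : Stacks ℓ) (l : List Γ') :
    step w { s with text := l } g = ((step w s g).1, { (step w s g).2 with text := l }) := by
  rcases w with ⟨_ | _ | _, ok, c⟩ <;> cases g <;> rfl

/-- Process the instance. -/
def consume (w : Control) : Prog ℓ Bool :=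
  loop (σ := Control) (fun w => (pop .text id).bind fun (o : Option Γ') =>
    match o with
    | none => pure (.inr w.2.1)
    | some g => (stepProg w g).bind fun w => pure (.inl w)) w

theorem runs_consume (w : Control) (l : List Γ') (s : Stacks ℓ) :
    (consume w).Runs { s with text := l }.get (run (w, s) l).1.2.1
      { (run (w, s) l).2 with text := [] }.get
      (l.length * (10 * (s.size + 2 * l.length) + 14) + 2) := by
  induction l generalizing w s with
  | nil =>
    refine (Runs.loop_exit (t := 1) (.pop_bind ?_)).mono (by simp)
    rw [Stacks.update_text]
    exact runs_pure ..
  | cons g l ih =>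
    have h := runs_stepProg w g { s with text := l }
    rw [step_text] at h
    have h' := ih (step w s g).1 (step w s g).2
    rw [run_cons]
    refine (Runs.loop_continue (t := 10 * s.size + 10 + 1) (.pop_bind ?_) h').mono ?_
    · rw [Stacks.update_text]
      exact h.bind_pure
    · have := size_step_le w g s
      have : l.length * (10 * ((step w s g).2.size + 2 * l.length) + 14) ≤
          l.length * (10 * (s.size + 2 * (l.length + 1)) + 14) :=
        Nat.mul_le_mul_left _ (by omega)
      rw [List.length_cons, add_one_mul]
      dsimp only at *
      omega

/-- The program of the verifier. -/
def program (ℓ : ℕ) : Prog ℓ Unit :=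
  (read 0).bind fun _ => (move .reversed .text id).bind fun _ =>
  (pushAll .rows (List.finRange ℓ)).bind fun _ => (consume (.graph, true, false)).bind fun b =>
  (clearAll [.colors, .visited, .current, .rows, .bound, .boundRev, .acc, .accRev]).bind fun _ =>
  push .output b

/-- The final configuration must have every stack but `output` empty; these three are not touched by
the pass and need no clearing. -/
theorem run_unused (w : Control × Stacks ℓ) (l : List Γ') :
    (run w l).2.input = w.2.input ∧ (run w l).2.reversed = w.2.reversed ∧
      (run w l).2.output = w.2.output := by
  induction l generalizing w with
  | nil => exact ⟨rfl, rfl, rfl⟩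
  | cons g l ih =>
    rw [run_cons]
    obtain ⟨⟨_ | _ | _, ok, c⟩, s⟩ := w <;> cases g <;> exact ih _

theorem runs_program (x : List Γ') (y : List Bool) :
    (program ℓ).Runs (single .input (x.map Sum.inl ++ y.map Sum.inr)) ()
      (single .output
        [(run (start (ℓ := ℓ) (parse y 0 (List.replicate x.length none))) x).1.2.1])
      (600 * (x.length + y.length) ^ 2 + 600 * (x.length + y.length) + 20 * ℓ + 100) := by
  set n := x.length + y.length with hn
  set L := parse (ℓ := ℓ) y 0 (List.replicate x.length none) with hL
  have hLn : L.length ≤ n := (parse_length_le ..).trans (by simp [hn])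
  have h1 := runs_read (ℓ := ℓ) {} 0 x y
  simp only [List.append_nil, ← hL] at h1
  have h2 := runs_move_reversed (ℓ := ℓ) { reversed := x.reverse, colors := L, current := L }
  simp only [List.append_nil, List.reverse_reverse, List.length_reverse] at h2
  have h3 : (pushAll (Γ := Symbol ℓ) .rows (List.finRange ℓ)).Runs
      (Stacks.get { text := x, colors := L, current := L }) ()
      { (start L).2 with text := x }.get ℓ :=
    (runs_pushAll ..).of_eq rfl (by rw [Stacks.update_rows]; simp [start, Stacks.get]) (by simp)
  have h4 := (runs_consume (.graph, true, false) x (start L).2).mono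
    (t' := 30 * n ^ 2 + 14 * n + 2) (by
      have hs : (start L).2.size = L.length := by simp [start, Stacks.size]
      rw [hs]
      have : x.length * (10 * (L.length + 2 * x.length) + 14) ≤ n * (10 * (n + 2 * n) + 14) := by
        gcongr <;> omega
      nlinarith)
  -- The stacks to be cleared are no longer than their initial lengths plus the time used by the
  -- pass.
  have h5 := runs_clearAll
    [.colors, .visited, .current, .rows, .bound, .boundRev, .acc, .accRev]
    { (run (start L) x).2 with text := [] }.get (n + ℓ + (30 * n ^ 2 + 14 * n + 2)) fun k => by
      refine (h4.length_le k).trans (Nat.add_le_add_right ?_ _)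
      cases k <;> simp [start, Stacks.get] <;> omega
  have h6 := runs_push (Γ := Symbol ℓ) .output (run (start L) x).1.2.1
    (fun k => if k ∈ ([.colors, .visited, .current, .rows, .bound, .boundRev, .acc, .accRev] :
      List Name) then [] else { (run (start L) x).2 with text := [] }.get k) 0
  refine (h1.bind (h2.bind (h3.bind (h4.bind (h5.bind h6))))).of_eq ?_ ?_ ?_
  · funext k
    cases k <;> simp [single, Stacks.get]
  · obtain ⟨h7, h8, h9⟩ := run_unused (start L) x
    funext k
    cases k <;> simp [single, Stacks.get, h7, h8, h9] <;> rfl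
  · simp only [List.length_cons, List.length_nil]
    omega

end Verifier

theorem Verifier.verify_polyTime (ℓ : ℕ) (𝒢 : GraphClass) :
    Nonempty (Turing.TM2ComputableInPolyTime
      (fun z : FairInstance ℓ 𝒢 × List Bool => z.1.encode.map Sum.inl ++ z.2.map Sum.inr)
      Computability.encodeBool fun z => Verifier.verify z.1 z.2) := by
  refine StackProgram.Code.polyTime (Verifier.program ℓ) .input .output (.refl _) (.refl _)
    (600 * Polynomial.X ^ 2 + 600 * Polynomial.X + Polynomial.C (20 * ℓ) + 100) fun z => ?_
  refine (Verifier.runs_program z.1.encode z.2).of_eq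
    (congrArg (StackProgram.single _) (List.map_id _)) rfl ?_
  simp

theorem fairDivision_inNP {ℓ : ℕ} (hℓ : 1 ≤ ℓ) (𝒢 : GraphClass) : (fairDivision ℓ 𝒢).InNP := by
  refine ⟨Polynomial.C (ℓ + 1) * Polynomial.X, fun z => Verifier.verify z.1 z.2,
    Verifier.verify_polyTime ℓ 𝒢, fun I => (Verifier.yes_iff_exists_verify hℓ I).trans ?_⟩
  simp only [Polynomial.eval_mul, Polynomial.eval_C, Polynomial.eval_X]
  rfl

/-! ### Reductions between the problems -/

/-- The restriction of a function that is computed in polynomial time. -/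
theorem nonempty_polyTime_comp {A A' B ΓA ΓB : Type} {ea : A → List ΓA} {ea' : A' → List ΓA}
    {eb : B → List ΓB} {f : A → B} (g : A' → A) (hg : ∀ a, ea (g a) = ea' a)
    (h : Nonempty (Turing.TM2ComputableInPolyTime ea eb f)) :
    Nonempty (Turing.TM2ComputableInPolyTime ea' eb (f ∘ g)) :=
  h.map fun M => ⟨M.toTM2ComputableAux, M.time, fun a => hg a ▸ M.outputsFun (g a)⟩

namespace DecisionProblem

theorem ReducesTo.trans {P Q R : DecisionProblem} (h : P.ReducesTo Q) (h' : Q.ReducesTo R) :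
    P.ReducesTo R := by
  obtain ⟨f, hf, hfy⟩ := h
  obtain ⟨g, hg, hgy⟩ := h'
  have := P.alphabetFintype
  have := Q.alphabetFintype
  exact ⟨g ∘ f, StackProgram.comp_polyTime hf hg, fun x => (hfy x).trans (hgy _)⟩

theorem NPComplete.of_reducesTo {P Q : DecisionProblem} (h : P.NPComplete) (hQ : Q.InNP)
    (h' : P.ReducesTo Q) : Q.NPComplete :=
  ⟨hQ, fun R hR => (h.2 R hR).trans h'⟩

/-- An instance keeps its encoding under restriction, so the same verifier and certificate bound
work. -/
theorem InNP.restrict {P : DecisionProblem} (h : P.InNP) (D : P.Inst → Prop) :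
    (P.restrict D).InNP := by
  obtain ⟨p, V, hV, hP⟩ := h
  exact ⟨p, _, nonempty_polyTime_comp (fun z : {x // D x} × List Bool => (z.1.1, z.2))
    (fun _ => rfl) hV, fun x => hP x.1⟩

end DecisionProblem

/-! ### The reduction from `k` to `k + 1` colors and the theorem. -/

namespace FairInstance

variable {k : ℕ} {𝒢 : GraphClass}

/-- The last two properties serve only the strong version. -/
theorem exists_reduction (h𝒢 : 𝒢.SustainableInPolyTime) (hk : 1 ≤ k) :
    ∃ f : FairInstance k 𝒢 → FairInstance (k + 1) 𝒢,
      Nonempty (Turing.TM2ComputableInPolyTime encode encode f) ∧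
      (∀ I, (fairDivision k 𝒢).Yes I ↔ (fairDivision (k + 1) 𝒢).Yes (f I)) ∧
      (∀ I, (f I).maxNum ≤ I.maxNum) ∧ ∀ I, I.encode.length ≤ (f I).encode.length := by
  obtain ⟨ext, hext, hpoly⟩ := h𝒢
  exact ⟨_, polyTime_extend hk (fun G hG => (hext G hG).1) hpoly,
    fun I => (yes_extend_iff I _ hk (hext _ I.mem).2).symm,
    fun I => maxNum_extend_le I _, fun I => length_encode_le_extend I _⟩

end FairInstance

theorem fairDivision_npComplete_succ {𝒢 : GraphClass} (h𝒢 : 𝒢.SustainableInPolyTime) {k : ℕ}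
    (hk : 1 ≤ k) (h : (fairDivision k 𝒢).NPComplete) : (fairDivision (k + 1) 𝒢).NPComplete := by
  obtain ⟨f, hf, hyes, -⟩ := FairInstance.exists_reduction h𝒢 hk
  exact h.of_reducesTo (fairDivision_inNP (by omega) 𝒢) ⟨f, hf, hyes⟩

theorem fairDivision_stronglyNPComplete_succ {𝒢 : GraphClass} (h𝒢 : 𝒢.SustainableInPolyTime)
    {k : ℕ} (hk : 1 ≤ k) (h : (fairDivision k 𝒢).StronglyNPComplete FairInstance.maxNum) :
    (fairDivision (k + 1) 𝒢).StronglyNPComplete FairInstance.maxNum := by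
  obtain ⟨f, hf, hyes, hmax, hlen⟩ := FairInstance.exists_reduction h𝒢 hk
  obtain ⟨-, p, hp⟩ := h
  have hNP : (fairDivision (k + 1) 𝒢).InNP := fairDivision_inNP (by omega) 𝒢
  -- The same polynomial `p` works: the numbers do not grow, the length does not drop, and `p` is
  -- monotone. The reduction is the same machine on fewer inputs.
  refine ⟨hNP, p, hp.of_reducesTo (hNP.restrict _) ⟨fun x => ⟨f x.1, ?_⟩, ?_, fun x => hyes x.1⟩⟩
  · exact (hmax x.1).trans (x.2.trans (StackProgram.eval_mono p (hlen x.1)))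
  · obtain ⟨M⟩ := hf
    exact ⟨M.toTM2ComputableAux, M.time, fun x => M.outputsFun x.1⟩

theorem theorem1 (𝒢 : GraphClass) (h𝒢 : 𝒢.SustainableInPolyTime) (k : ℕ) (hk : 1 ≤ k) :
    ((fairDivision k 𝒢).NPComplete →
      ∀ ℓ : ℕ, k ≤ ℓ → (fairDivision ℓ 𝒢).NPComplete) ∧
    ((fairDivision k 𝒢).StronglyNPComplete FairInstance.maxNum →
      ∀ ℓ : ℕ, k ≤ ℓ → (fairDivision ℓ 𝒢).StronglyNPComplete FairInstance.maxNum) := by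
  refine ⟨fun h ℓ hℓ => ?_, fun h ℓ hℓ => ?_⟩
  · induction ℓ, hℓ using Nat.le_induction with
    | base => exact h
    | succ ℓ hℓ ih => exact fairDivision_npComplete_succ h𝒢 (hk.trans hℓ) ih
  · induction ℓ, hℓ using Nat.le_induction with
    | base => exact h
    | succ ℓ hℓ ih => exact fairDivision_stronglyNPComplete_succ h𝒢 (hk.trans hℓ) ih
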